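/- **Setting.** Let $\mathcal A$ be a set of sensing actions, $\theta_0$ a pre-change parameter and $\Theta^{(1)}$ a finite nonempty set of post-change parameters. For $\theta\in\Theta^{(1)}\cup\{\theta_0\}$ and $a\in\mathcal A$ let $\theta(a)=\mathbb P_\theta(\cdot\mid a)$ be a probability distribution on an observation space, with density (or mass function) $f_\theta(\cdot\mid a)$ with respect to a reference measure that does not depend on $\theta$; write $D(\cdot\|\cdot)$ for the Kullback–Leibler divergence. If the change to $\theta^*\in\Theta^{(1)}$ happens at time $\nu\in\mathbb N=\{1,2,\dots\}$, playing $A_t$ in round $t$ yields an observation $X_t\sim\theta_t(A_t)$, independent of the past given $A_t$, where $\theta_t=\theta_0$ for $t<\nu$ and $\theta_t=\theta^*$ for $t\ge\nu$. $\mathbb P^{(\nu,\theta^*)}$ and $\mathbb P^{(\infty)}$ denote the law of the process with this change and without any change. **Assumptions.** (i) For every $\theta\in\Theta^{(1)}$ there is $a$ with $D(\theta(a)\|\theta_0(a))>0$, and for all $\theta\ne\theta'$ in $\Theta^{(1)}$ there is $a$ with $D(\theta(a)\|\theta'(a))>0$. (ii) $D(\theta_1(a)\|\theta_2(a))\le D_{\max}$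 for all $a\in\mathcal A$, $\theta_1,\theta_2\in\Theta^{(1)}$. (iii) There is $r>0$ such that for all $\theta,\theta',\theta''\in\Theta^{(1)}\cup\{\theta_0\}$ and $a\in\mathcal A$, under $X\sim\theta(a)$ the variable $Z=\log\frac{f_{\theta'}(X\mid a)}{f_{\theta''}(X\mid a)}$ is almost surely well defined and finite and is $r$-subgaussian: $\mathbb E[e^{\lambda(Z-\mathbb E Z)}]\le e^{\lambda^2 r/2}$ for all $\lambda\in\mathbb R$. **Algorithm ($\epsilon$-GCD with log-likelihood CUSUM statistics).** Its inputs are $\epsilon\in[0,1]$, a probability distribution $\pi$ on $\mathcal A$, a threshold $\beta\ge1$ and, for each $\theta\in\Theta^{(1)}$, a most informative action $a^*_\theta\in\operatorname{argmax}_{a}D(\theta(a)\|\theta_0(a))$ (the maximum is assumed to be attained). Put $Q^{(1)}_1(\theta)=Q^{(2)}_1(\theta)=0$. In round $t=1,2,\dots$: stop, with $\tau=t$, if $\max_{\theta\in\Theta^{(1)}}Q^{(2)}_t(\theta)\ge\log\beta$; otherwise draw $E_t\sim\mathrm{Ber}(\epsilon)$ independently; if $E_t=1$ play $A_t\sim\pi$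 independently, and if $E_t=0$ play $A_t=a^*_{\hat\theta_t}$ with $\hat\theta_t\in\operatorname{argmax}_\theta Q^{(1)}_t(\theta)$, ties being broken by an arbitrary fixed measurable rule; then observe $X_t$ and, with $g_\theta(x,a)=\log\frac{f_\theta(x\mid a)}{f_{\theta_0}(x\mid a)}$, set $$Q^{(1)}_{t+1}(\theta)=\big(Q^{(1)}_t(\theta)+E_t\,g_\theta(X_t,A_t)\big)^+,\qquad Q^{(2)}_{t+1}(\theta)=\big(Q^{(2)}_t(\theta)+(1-E_t)\,g_\theta(X_t,A_t)\big)^+ .$$ Put $\tau=\infty$ if the rule never stops. For the definition of $Q^{(1)}_\nu$ the sampling process is continued beyond $\tau$. **Notation.** $\mu^*=\max_{a}D(\theta^*(a)\|\theta_0(a))$; $\bar D(\theta^*\|\theta)=\sum_a\pi(a)D(\theta^*(a)\|\theta(a))$ (an integral against $\pi$ if $\pi$ is not discrete); the gap of $\theta$ is $\Delta_\theta=\bar D(\theta^*\|\theta_0)-\frac12\big(\bar D(\theta^*\|\theta_0)+(\bar D(\theta^*\|\theta_0)-\bar D(\theta^*\|\theta))^+\big)$; and $\gamma=r+r^2+2D_{\max}^2$.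 **Theorem.** Under assumptions (i)–(iii): 1. (Time to false alarm) If $\alpha\in(0,1)$, $m\in\mathbb N$ and $\beta\ge m|\Theta^{(1)}|/\alpha$, then $\mathbb P^{(\infty)}[\tau<m]\le\alpha$. 2. (Detection delay) Let $0<\epsilon<1$, $\beta\ge1$, $\theta^*\in\Theta^{(1)}$ and $\nu\in\mathbb N$. Suppose that $\pi(a^*_{\theta^*})>0$ and that $\bar D(\theta^*\|\theta)>0$ for every $\theta\in\Theta^{(1)}$ with $a^*_\theta\ne a^*_{\theta^*}$. Then $\mathbb E^{(\infty)}[Q^{(1)}_\nu(\theta)]<\infty$ for all $\theta\in\Theta^{(1)}$, and $$\mathbb E^{(\nu,\theta^*)}[(\tau-\nu)^+]\le\frac{8\log\beta}{(1-\epsilon)\mu^*}+\frac{100}{1-\epsilon}\Big(1+\frac{r}{(\mu^*)^2}\Big)+\sum_{\theta\in\Theta^{(1)}:\,a^*_\theta\ne a^*_{\theta^*}}\left[\frac{4\,\mathbb E^{(\infty)}[Q^{(1)}_\nu(\theta)]}{\epsilon\,\Delta_\theta}+8\Big(1+\frac{8\gamma}{\epsilon^2\Delta_\theta^2}\Big)^2\right].$$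 -/

import Mathlib

open MeasureTheory ProbabilityTheory InformationTheory
open scoped ENNReal NNReal

/-- A bandit quickest change detection model: parameters `Par`, sensing actions `A`, observations
in `X`. `obs θ a` is the law of the observation when action `a` is played under parameter `θ`; it
has the density (or mass function) `dens θ a` with respect to a reference measure `ref a`.
`θ₀` is the pre-change parameter and the finite set `Θ₁` holds the post-change parameters. -/
structure BanditModel (Par A X : Type*) [MeasurableSpace A] [MeasurableSpace X] where
  θ₀ : Par
  Θ₁ : Finset Par
  obs : Par → Kernel A X
  markov : ∀ θ, IsMarkovKernel (obs θ)
  ref : A → Measure X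
  dens : Par → A → X → ℝ
  dens_nonneg : ∀ θ a x, 0 ≤ dens θ a x
  measurable_dens : ∀ θ, Measurable fun p : A × X => dens θ p.1 p.2
  obs_eq : ∀ θ a, obs θ a = (ref a).withDensity fun x => ENNReal.ofReal (dens θ a x)

namespace BanditModel

variable {Par A X : Type*} [MeasurableSpace A] [MeasurableSpace X] (M : BanditModel Par A X)

instance instMarkovObs (θ : Par) : IsMarkovKernel (M.obs θ) := M.markov θ

/-- The divergence `D(θ(a) ‖ θ'(a))`. -/
noncomputable def kl (θ θ' : Par) (a : A) : ℝ≥0∞ := klDiv (M.obs θ a) (M.obs θ' a)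

/-- The log-likelihood ratio `log (f_θ(x|a) / f_θ'(x|a))`. -/
noncomputable def logLR (θ θ' : Par) (a : A) (x : X) : ℝ :=
  Real.log (M.dens θ a x / M.dens θ' a x)

/-- Every post-change parameter is detectable by some action, and any two distinct post-change
parameters are separated by some action. -/
def Identifiable : Prop :=
  (∀ θ ∈ M.Θ₁, ∃ a, 0 < M.kl θ M.θ₀ a) ∧
    ∀ θ ∈ M.Θ₁, ∀ θ' ∈ M.Θ₁, θ ≠ θ' → ∃ a, 0 < M.kl θ θ' a

/-- All divergences between post-change parameters are at most `D`. -/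
def BoundedKL (D : ℝ≥0) : Prop :=
  ∀ θ ∈ M.Θ₁, ∀ θ' ∈ M.Θ₁, ∀ a, M.kl θ θ' a ≤ D

/-- For all `θ, θ', θ''` in `Θ₁ ∪ {θ₀}` and all actions `a`, the log-likelihood ratio of `θ'`
against `θ''` is almost surely a well-defined real number under `obs θ a`, and it is
`r`-subgaussian there: `E exp (l (Z - E Z)) ≤ exp (r l ^ 2 / 2)` for all real `l`. -/
def SubgaussianLLR (r : ℝ≥0) : Prop :=
  ∀ θ θ' θ'' : Par, (θ = M.θ₀ ∨ θ ∈ M.Θ₁) → (θ' = M.θ₀ ∨ θ' ∈ M.Θ₁) →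
    (θ'' = M.θ₀ ∨ θ'' ∈ M.Θ₁) → ∀ a,
      (∀ᵐ x ∂(M.obs θ a), 0 < M.dens θ' a x ∧ 0 < M.dens θ'' a x) ∧
      HasSubgaussianMGF
        (fun x => M.logLR θ' θ'' a x - ∫ y, M.logLR θ' θ'' a y ∂(M.obs θ a)) r (M.obs θ a)

/-- `max_a D(θ(a) ‖ θ₀(a))`. -/
noncomputable def maxKL (θ : Par) : ℝ := (⨆ a, M.kl θ M.θ₀ a).toReal

/-- What happens in one round: the exploration indicator `E`, the action `A`, the
observation `X`. -/
abbrev Round (A X : Type*) := Bool × A × X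

/-- `Q⁽¹⁾_{n+1}`, the exploration CUSUM statistics after the first `n` rounds; `ω i` is the outcome
of round `i + 1`. -/
noncomputable def exploreAfter (ω : ℕ → Round A X) : ℕ → M.Θ₁ → ℝ
  | 0, _ => 0
  | n + 1, θ => max (exploreAfter ω n θ +
      if (ω n).1 = true then M.logLR θ M.θ₀ (ω n).2.1 (ω n).2.2 else 0) 0

/-- `Q⁽²⁾_{n+1}`, the exploitation CUSUM statistics after the first `n` rounds. -/
noncomputable def exploitAfter (ω : ℕ → Round A X) : ℕ → M.Θ₁ → ℝ
  | 0, _ => 0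
  | n + 1, θ => max (exploitAfter ω n θ +
      if (ω n).1 = true then 0 else M.logLR θ M.θ₀ (ω n).2.1 (ω n).2.2) 0

/-- `Q⁽¹⁾_t`, the exploration statistics at the beginning of round `t ≥ 1`. -/
noncomputable def Q1 (ω : ℕ → Round A X) (t : ℕ) : M.Θ₁ → ℝ := M.exploreAfter ω (t - 1)

/-- `Q⁽²⁾_t`, the exploitation statistics at the beginning of round `t ≥ 1`. -/
noncomputable def Q2 (ω : ℕ → Round A X) (t : ℕ) : M.Θ₁ → ℝ := M.exploitAfter ω (t - 1)

/-- The first round `t ≥ 1` with `max_θ Q⁽²⁾_t(θ) ≥ log β` (`⊤` if there is none). -/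
noncomputable def stopTime (β : ℝ) (ω : ℕ → Round A X) : ℕ∞ :=
  ⨅ t ∈ {t : ℕ | 1 ≤ t ∧ ∃ θ : M.Θ₁, Real.log β ≤ M.Q2 ω t θ}, (t : ℕ∞)

theorem measurable_logLR (θ θ' : Par) : Measurable fun p : A × X => M.logLR θ θ' p.1 p.2 :=
  Real.measurable_log.comp ((M.measurable_dens θ).div (M.measurable_dens θ'))

theorem measurable_exploreAfter (n : ℕ) :
    Measurable fun ω : ℕ → Round A X => M.exploreAfter ω n := by
  induction n with
  | zero => exact measurable_pi_lambda _ fun θ => by simp [exploreAfter]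
  | succ n ih =>
    refine measurable_pi_lambda _ fun θ => ?_
    simp only [exploreAfter]
    have hn : Measurable fun ω : ℕ → Round A X => ω n := measurable_pi_apply n
    refine Measurable.max (((measurable_pi_apply θ).comp ih).add ?_) measurable_const
    refine Measurable.ite ?_ ((M.measurable_logLR θ M.θ₀).comp hn.snd) measurable_const
    exact hn.fst (measurableSet_singleton true)

/-- The parameter in force at round `t` when the change to `θ` takes place at time `ν`. -/
def changeAt (ν : ℕ) (θ : Par) (t : ℕ) : Par := if t < ν then M.θ₀ else θ

/-- No change. -/
def noChange (_ : ℕ) : Par := M.θ₀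

end BanditModel

/-- The inputs of the ε-greedy change detector other than the threshold: the exploration rate `ε`,
the exploration distribution `π`, a most informative action `best θ` for every post-change
parameter `θ`, and a measurable selection `select q` of a maximiser of `q : Θ₁ → ℝ` (the
tie-breaking rule in the computation of the estimate of the post-change parameter). -/
structure EpsGCD {Par A X : Type*} [MeasurableSpace A] [MeasurableSpace X]
    (M : BanditModel Par A X) where
  ε : unitInterval
  π : Measure A
  prob : IsProbabilityMeasure π
  best : M.Θ₁ → A
  best_max : ∀ (θ : M.Θ₁) (a : A), M.kl θ M.θ₀ a ≤ M.kl θ M.θ₀ (best θ)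
  select : (M.Θ₁ → ℝ) → M.Θ₁
  select_max : ∀ (q : M.Θ₁ → ℝ) (θ : M.Θ₁), q θ ≤ q (select q)
  measurable_select : ∀ θ, MeasurableSet (select ⁻¹' {θ})

namespace EpsGCD

open BanditModel

variable {Par A X : Type*} [MeasurableSpace A] [MeasurableSpace X] {M : BanditModel Par A X}
  (G : EpsGCD M)

instance instProbExplore : IsProbabilityMeasure G.π := G.prob

theorem measurable_greedy : Measurable fun q : M.Θ₁ → ℝ => G.best (G.select q) := by
  intro S _
  have : (fun q : M.Θ₁ → ℝ => G.best (G.select q)) ⁻¹' S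
      = ⋃ θ ∈ {θ : M.Θ₁ | G.best θ ∈ S}, G.select ⁻¹' {θ} := by
    ext q; simp
  rw [this]
  exact MeasurableSet.biUnion (Set.to_countable _) fun θ _ => G.measurable_select θ

/-- The law of the action, given the exploration statistics `q` and the indicator `E`: `π` in an
exploration round, the most informative action for the estimate in an exploitation round. -/
noncomputable def actionKernel : Kernel ((M.Θ₁ → ℝ) × Bool) A where
  toFun p := if p.2 = true then G.π else Measure.dirac (G.best (G.select p.1))
  measurable' := Measurable.ite (measurable_snd (measurableSet_singleton true)) measurable_const
    (Measure.measurable_dirac.comp (G.measurable_greedy.comp measurable_fst))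

theorem actionKernel_apply (p : (M.Θ₁ → ℝ) × Bool) :
    G.actionKernel p = if p.2 = true then G.π else Measure.dirac (G.best (G.select p.1)) := rfl

instance instMarkovAction : IsMarkovKernel G.actionKernel := by
  refine ⟨fun p => ?_⟩
  rw [actionKernel_apply]
  split_ifs <;> infer_instance

/-- The law of `(E, A, X)` in a round governed by the parameter `θ`, given the exploration
statistics at its beginning: `E` is Bernoulli with mean `ε`, then `A`, then `X ∼ obs θ A`. -/
noncomputable def roundKernel (θ : Par) : Kernel (M.Θ₁ → ℝ) (Round A X) :=
  Kernel.const _ (bernoulliMeasure true false G.ε) ⊗ₖ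
    (G.actionKernel ⊗ₖ (M.obs θ).comap Prod.snd measurable_snd)

instance instMarkovRound (θ : Par) : IsMarkovKernel (G.roundKernel θ) := by
  unfold roundKernel; infer_instance

/-- The exploration statistics after `n + 1` rounds, computed from the outcomes of these. -/
noncomputable def statFromPast (M : BanditModel Par A X) (n : ℕ)
    (h : (i : Finset.Iic n) → Round A X) : M.Θ₁ → ℝ :=
  M.exploreAfter (fun i => h ⟨min i n, Finset.mem_Iic.2 (min_le_right i n)⟩) (n + 1)

theorem measurable_statFromPast (n : ℕ) : Measurable (statFromPast M n) :=
  (M.measurable_exploreAfter (n + 1)).comp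
    (measurable_pi_lambda _ fun _ => measurable_pi_apply _)

/-- The law of the sequence of round outcomes (round `n + 1` is coordinate `n`) when round `t` is
governed by the parameter `sched t`. The process is run for ever; the stopping rule is a function of
it. -/
noncomputable def law (sched : ℕ → Par) : Measure (ℕ → Round A X) :=
  Kernel.trajMeasure (X := fun _ => Round A X) (G.roundKernel (sched 1) (fun _ => 0))
    fun n => (G.roundKernel (sched (n + 2))).comap (statFromPast M n) (measurable_statFromPast n)

/-- `∑_a π(a) D(θ(a) ‖ θ'(a))`. -/
noncomputable def avgKL (θ θ' : Par) : ℝ := (∫⁻ a, M.kl θ θ' a ∂G.π).toReal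

/-- The gap `Δ_θ` of `θ` with respect to the true post-change parameter `θs`. -/
noncomputable def gap (θs θ : Par) : ℝ :=
  G.avgKL θs M.θ₀ -
    (G.avgKL θs M.θ₀ + max (G.avgKL θs M.θ₀ - G.avgKL θs θ) 0) / 2

open scoped Classical in
/-- The post-change parameters whose most informative action is not that of `θs`. -/
noncomputable def rivals (θs : M.Θ₁) : Finset M.Θ₁ :=
  Finset.univ.filter fun θ => G.best θ ≠ G.best θs

end EpsGCD

/-!
False alarms. Without a change, the likelihood ratio of `θ` has mean one under the law of the
observation, so the exponential of the exploitation CUSUM statistic of `θ`, stopped when it reaches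
`β`, grows by at most one per round in the mean (`EpsGCD.lintegral_stopped_le`). Markov's inequality
and a union bound over `θ` give the first claim.

Consequences of subgaussianity. The mean of `f_θ' / f_θ` under `θ` is one; comparing this with the
subgaussian bound at `-1` shows that every divergence of the model is at most `r / 2`
(`BanditModel.SubgaussianLLR.toReal_kl_le`). So the conditional mean of an exploration increment
given the action lies in `[-r/2, r/2]`, and by Hoeffding's lemma the centred increment is subgaussian
with parameter `r + (r/2)²` (`EpsGCD.lintegral_exp_exploreIncr_le`), which is at most `γ`. The bound
`D_max` enters only through `γ`.

Wrong estimates. After the change, the exploration statistic of the true parameter `θs` drifts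
upwards at least `2 ε Δ_θ` per round faster than that of a rival `θ`. If `θ` is not behind `θs`
after `n` rounds, then either the statistic of `θ` was at least `ε Δ_θ n / 2` at the change, or one
of `n + 1` centred sums exceeds `ε Δ_θ n / 2` (`EpsGCD.overtake_cases`). Summing over `n`, the first
case contributes `2 E[Q⁽¹⁾_ν(θ)] / (ε Δ_θ)` and the second, by Chernoff's bound, at most
`∑ (n + 1) e^{-n/x} ≤ (1 + x)²` with `x = 8 γ / (ε Δ_θ)²` (`EpsGCD.tsum_measure_overtake_le`).

Delay. Let `μ` be the largest divergence of `θs` from the pre-change parameter and `0 ≤ l ≤ 1`.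
The factor `e^{-l Z}` of an exploitation round, `Z` being the log-likelihood ratio of `θs`, has mean
at most one whatever the action, since a power `l` of a likelihood ratio does, and mean at most
`e^{-l μ / 2}` if the action is the right one and `r l ≤ μ`
(`EpsGCD.lintegral_exploitFactor_le_one`). Hence `e^{-l S + y K}` has mean at most one, where `S` is
the sum of the exploitation increments of `θs` after the change, `K` the number of rounds with a
right greedy action, and `y = (1 - ε) l μ / 4`. If the procedure has not stopped `n` rounds after the
change, then `S < log β`. The probability that moreover `K ≥ n / 2` decays geometrically once `n`
exceeds `8 log β / ((1 - ε) μ)`. Otherwise more than half of the `n` greedy actions were wrong, which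
happens for at most twice as many `n` as there are wrong greedy actions (`EpsGCD.delay_le`), and the
expected number of the latter is bounded by the previous paragraph.
-/

/-! ### The law of the sampling process -/

namespace EpsGCD

open BanditModel Preorder

variable {Par A X : Type*} [MeasurableSpace A] [MeasurableSpace X] {M : BanditModel Par A X}
  (G : EpsGCD M)

instance instProbLaw (sched : ℕ → Par) : IsProbabilityMeasure (G.law sched) := by
  unfold law; infer_instance

theorem lintegral_roundKernel (θ : Par) (q : M.Θ₁ → ℝ) {f : Round A X → ℝ≥0∞}
    (hf : Measurable f) :
    ∫⁻ x, f x ∂(G.roundKernel θ q) =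
      ENNReal.ofReal G.ε * ∫⁻ a, ∫⁻ x, f (true, a, x) ∂(M.obs θ a) ∂G.π
      + ENNReal.ofReal (1 - G.ε) *
        ∫⁻ x, f (false, G.best (G.select q), x) ∂(M.obs θ (G.best (G.select q))) := by
  have hin : ∀ b : Bool, Measurable fun a => ∫⁻ x, f (b, a, x) ∂(M.obs θ a) := fun b =>
    Measurable.lintegral_kernel_prod_right' (κ := M.obs θ)
      (f := fun p : A × X => f (b, p.1, p.2)) (hf.comp (by fun_prop))
  have h : ∀ b : Bool, ∫⁻ c, f (b, c) ∂(G.actionKernel ⊗ₖ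
      (M.obs θ).comap Prod.snd measurable_snd) (q, b)
      = if b = true then ∫⁻ a, ∫⁻ x, f (true, a, x) ∂(M.obs θ a) ∂G.π else
        ∫⁻ x, f (false, G.best (G.select q), x) ∂(M.obs θ (G.best (G.select q))) := by
    intro b
    have hfb : Measurable fun c : A × X => f (b, c) := hf.comp (by fun_prop)
    rw [Kernel.lintegral_compProd _ _ _ hfb]
    simp only [Kernel.comap_apply, actionKernel_apply]
    cases b
    · simp [lintegral_dirac' _ (hin false)]
    · simp
  rw [roundKernel, Kernel.lintegral_compProd _ _ _ hf, Kernel.const_apply]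
  simp only [h]
  rw [bernoulliMeasure_def]
  have h1 : ((unitInterval.toNNReal G.ε : ℝ≥0) : ℝ≥0∞) = ENNReal.ofReal G.ε := by
    rw [ENNReal.ofReal]; congr 1
    ext; simp [G.ε.2.1]
  have h2 : ((unitInterval.toNNReal (unitInterval.symm G.ε) : ℝ≥0) : ℝ≥0∞)
      = ENNReal.ofReal (1 - G.ε) := by
    rw [ENNReal.ofReal]; congr 1
    ext; simp [G.ε.2.2]
  simp only [lintegral_add_measure, lintegral_smul_measure, lintegral_dirac, ENNReal.smul_def,
    h1, h2, smul_eq_mul, if_true, Bool.false_eq_true, if_false]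

theorem exploreAfter_congr {n : ℕ} {ω ω' : ℕ → Round A X} (h : ∀ i < n, ω i = ω' i) :
    M.exploreAfter ω n = M.exploreAfter ω' n := by
  induction n with
  | zero => rfl
  | succ n ih =>
    funext θ
    simp only [exploreAfter]
    rw [ih fun i hi => h i (hi.trans n.lt_succ_self), h n n.lt_succ_self]

theorem exploitAfter_congr {n : ℕ} {ω ω' : ℕ → Round A X} (h : ∀ i < n, ω i = ω' i) :
    M.exploitAfter ω n = M.exploitAfter ω' n := by
  induction n with
  | zero => rfl
  | succ n ih =>
    funext θ
    simp only [exploitAfter]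
    rw [ih fun i hi => h i (hi.trans n.lt_succ_self), h n n.lt_succ_self]

theorem map_law_frestrictLe_zero (sched : ℕ → Par) :
    (G.law sched).map (fun ω => ω 0) = G.roundKernel (sched 1) (fun _ => 0) := by
  have h1 : (G.law sched).map (frestrictLe (π := fun _ => Round A X) 0) =
      (G.roundKernel (sched 1) (fun _ => 0)).map
        (MeasurableEquiv.piUnique fun _ : Finset.Iic 0 => Round A X).symm := by
    rw [law, Kernel.trajMeasure, Measure.map_comp _ _ (by fun_prop),
      Kernel.traj_map_frestrictLe, Kernel.partialTraj_self, Measure.id_comp]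
  have h2 : (G.law sched).map (fun ω => ω 0) =
      ((G.law sched).map (frestrictLe (π := fun _ => Round A X) 0)).map
        (fun h => h ⟨0, by simp⟩) := by
    rw [Measure.map_map (by fun_prop) (by fun_prop)]
    rfl
  rw [h2, h1, Measure.map_map (by fun_prop) (by fun_prop)]
  convert Measure.map_id using 2
  rfl

/-- The Markov property in integrated form: given the first `n` rounds, the next one is drawn
from the round kernel at the current exploration statistics. -/
theorem lintegral_law_step (sched : ℕ → Par) (n : ℕ)
    {F : (ℕ → Round A X) → Round A X → ℝ≥0∞} (hF : Measurable (Function.uncurry F))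
    (hdep : ∀ x ω ω', (∀ i < n, ω i = ω' i) → F ω x = F ω' x) :
    ∫⁻ ω, F ω (ω n) ∂(G.law sched) =
      ∫⁻ ω, ∫⁻ x, F ω x ∂(G.roundKernel (sched (n + 1)) (M.exploreAfter ω n))
        ∂(G.law sched) := by
  cases n with
  | zero =>
    obtain ⟨ω₀⟩ := nonempty_of_isProbabilityMeasure (G.law sched)
    have h : ∀ ω x, F ω x = F ω₀ x := fun ω x => hdep x ω ω₀ (by simp)
    simp only [h, exploreAfter, lintegral_const, measure_univ, mul_one]
    have hm : Measurable (F ω₀) := hF.comp (measurable_const.prodMk measurable_id)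
    have := G.map_law_frestrictLe_zero sched
    rw [← lintegral_map (f := F ω₀) hm (measurable_pi_apply 0), this]
  | succ n =>
    set ext : ((i : Finset.Iic n) → Round A X) → ℕ → Round A X :=
      fun h i => h ⟨min i n, Finset.mem_Iic.2 (min_le_right i n)⟩ with hext
    have hextm : Measurable ext := measurable_pi_lambda _ fun _ => measurable_pi_apply _
    have hagree : ∀ ω : ℕ → Round A X, ∀ i < n + 1,
        ω i = ext (frestrictLe (π := fun _ => Round A X) n ω) i := by
      intro ω i hi
      simp only [hext, frestrictLe_apply]
      rw [min_eq_left (by omega)]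
    have hFe : ∀ ω x, F ω x = F (ext (frestrictLe (π := fun _ => Round A X) n ω)) x :=
      fun ω x => hdep x _ _ (hagree ω)
    have hq : ∀ ω, M.exploreAfter ω (n + 1)
        = statFromPast M n (frestrictLe (π := fun _ => Round A X) n ω) :=
      fun ω => exploreAfter_congr (hagree ω)
    have hF' : Measurable fun p : ((i : Finset.Iic n) → Round A X) × Round A X =>
        F (ext p.1) p.2 :=
      hF.comp ((hextm.comp measurable_fst).prodMk measurable_snd)
    have key := Kernel.map_frestrictLe_trajMeasure_compProd_eq_map_trajMeasure
      (X := fun _ => Round A X) (μ₀ := G.roundKernel (sched 1) (fun _ => 0))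
      (κ := fun n => (G.roundKernel (sched (n + 2))).comap (statFromPast M n)
        (measurable_statFromPast n)) (a := n)
    change (G.law sched).map _ ⊗ₘ _ = (G.law sched).map _ at key
    have h1 := congrArg (fun μ => ∫⁻ p, F (ext p.1) p.2 ∂μ) key
    rw [Measure.lintegral_compProd hF', lintegral_map _ (by fun_prop),
      lintegral_map hF' (by fun_prop)] at h1
    · calc ∫⁻ ω, F ω (ω (n + 1)) ∂(G.law sched)
          = ∫⁻ ω, F (ext (frestrictLe (π := fun _ => Round A X) n ω)) (ω (n + 1))
              ∂(G.law sched) := lintegral_congr fun ω => hFe ω _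
        _ = _ := h1.symm
        _ = _ := lintegral_congr fun ω => by
          rw [hq, Kernel.comap_apply]
          exact lintegral_congr fun x => (hFe ω x).symm
    · exact Measurable.lintegral_kernel_prod_right' hF'

theorem lintegral_roundKernel_measurable (θ : Par) (n : ℕ)
    {F : (ℕ → Round A X) → Round A X → ℝ≥0∞} (hF : Measurable (Function.uncurry F)) :
    Measurable fun ω => ∫⁻ x, F ω x ∂(G.roundKernel θ (M.exploreAfter ω n)) :=
  Measurable.lintegral_kernel_prod_right'
    (κ := (G.roundKernel θ).comap (fun ω => M.exploreAfter ω n) (M.measurable_exploreAfter n)) hF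

/-- The law of the first `n` rounds depends only on the parameters in force in these rounds. -/
theorem lintegral_law_congr {sched sched' : ℕ → Par} (n : ℕ)
    (hs : ∀ t, 1 ≤ t → t ≤ n → sched t = sched' t)
    {f : (ℕ → Round A X) → ℝ≥0∞} (hf : Measurable f)
    (hdep : ∀ ω ω', (∀ i < n, ω i = ω' i) → f ω = f ω') :
    ∫⁻ ω, f ω ∂(G.law sched) = ∫⁻ ω, f ω ∂(G.law sched') := by
  induction n generalizing f with
  | zero =>
    obtain ⟨ω₀⟩ := nonempty_of_isProbabilityMeasure (G.law sched)
    simp [fun ω => hdep ω ω₀ (by simp)]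
  | succ n ih =>
    let F : (ℕ → Round A X) → Round A X → ℝ≥0∞ := fun ω x => f (Function.update ω n x)
    have hF : Measurable (Function.uncurry F) := by
      refine hf.comp (measurable_pi_lambda _ fun i => ?_)
      by_cases hi : i = n
      · subst hi; simpa using measurable_snd
      · simpa [hi] using measurable_fst.eval
    have hFdep : ∀ x ω ω', (∀ i < n, ω i = ω' i) → F ω x = F ω' x := by
      intro x ω ω' h
      refine hdep _ _ fun i hi => ?_
      by_cases hin : i = n
      · subst hin; simp
      · simpa [hin] using h i (by omega)
    have hfF : ∀ ω, f ω = F ω (ω n) := fun ω => by simp [F]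
    simp only [hfF]
    rw [G.lintegral_law_step sched n hF hFdep, G.lintegral_law_step sched' n hF hFdep,
      hs (n + 1) (by omega) le_rfl]
    refine ih (fun t h1 h2 => hs t h1 (by omega)) (G.lintegral_roundKernel_measurable _ n hF) ?_
    intro ω ω' h
    rw [exploreAfter_congr h]
    exact lintegral_congr fun x => hFdep x _ _ h

/-- A product of factors, each of conditional mean at most one given the past, has mean at most
one. -/
theorem lintegral_prod_le_one (sched : ℕ → Par) {θ : Par} {k n : ℕ}
    (hs : ∀ s, k ≤ s → s < n → sched (s + 1) = θ)
    {u : (M.Θ₁ → ℝ) → Round A X → ℝ≥0∞} (hu : Measurable (Function.uncurry u))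
    (hu1 : ∀ q, ∫⁻ x, u q x ∂(G.roundKernel θ q) ≤ 1) :
    ∫⁻ ω, ∏ s ∈ Finset.Ico k n, u (M.exploreAfter ω s) (ω s) ∂(G.law sched) ≤ 1 := by
  induction n with
  | zero => simp
  | succ n ih =>
    rcases Nat.lt_or_ge n k with hk | hk
    · simp [Finset.Ico_eq_empty_of_le (show n + 1 ≤ k from hk)]
    have hmeas : ∀ s, Measurable fun ω : ℕ → Round A X => u (M.exploreAfter ω s) (ω s) :=
      fun s => hu.comp ((M.measurable_exploreAfter s).prodMk (measurable_pi_apply s))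
    have hprod : Measurable fun ω : ℕ → Round A X =>
        ∏ s ∈ Finset.Ico k n, u (M.exploreAfter ω s) (ω s) :=
      Finset.measurable_fun_prod _ fun s _ => hmeas s
    let F : (ℕ → Round A X) → Round A X → ℝ≥0∞ := fun ω x =>
      (∏ s ∈ Finset.Ico k n, u (M.exploreAfter ω s) (ω s)) * u (M.exploreAfter ω n) x
    have hF : Measurable (Function.uncurry F) :=
      (hprod.comp measurable_fst).mul (hu.comp
        (((M.measurable_exploreAfter n).comp measurable_fst).prodMk measurable_snd))
    have hFdep : ∀ x ω ω', (∀ i < n, ω i = ω' i) → F ω x = F ω' x := by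
      intro x ω ω' h
      simp only [F]
      rw [exploreAfter_congr h]
      congr 1
      refine Finset.prod_congr rfl fun s hs => ?_
      have hsn := (Finset.mem_Ico.1 hs).2
      rw [exploreAfter_congr fun i hi => h i (hi.trans hsn), h s hsn]
    calc ∫⁻ ω, ∏ s ∈ Finset.Ico k (n + 1), u (M.exploreAfter ω s) (ω s) ∂(G.law sched)
        = ∫⁻ ω, F ω (ω n) ∂(G.law sched) := by
          simp only [F, Finset.prod_Ico_succ_top hk]
      _ = _ := G.lintegral_law_step sched n hF hFdep
      _ ≤ ∫⁻ ω, ∏ s ∈ Finset.Ico k n, u (M.exploreAfter ω s) (ω s) ∂(G.law sched) := by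
          refine lintegral_mono fun ω => ?_
          simp only [F]
          rw [lintegral_const_mul _ (hu.of_uncurry_left), hs n hk n.lt_succ_self]
          exact mul_le_of_le_one_right' (hu1 _)
      _ ≤ 1 := ih fun s h1 h2 => hs s h1 (h2.trans n.lt_succ_self)

end EpsGCD

/-! ### Log-likelihood ratios and divergences -/

namespace BanditModel

variable {Par A X : Type*} [MeasurableSpace A] [MeasurableSpace X] {M : BanditModel Par A X}

variable (M) in
/-- The parameters that occur in the model: the pre-change and the post-change ones. -/
def IsParam (θ : Par) : Prop := θ = M.θ₀ ∨ θ ∈ M.Θ₁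

theorem isParam_pre : M.IsParam M.θ₀ := Or.inl rfl

theorem isParam_post (θ : M.Θ₁) : M.IsParam θ := Or.inr θ.2

theorem measurable_dens_apply (θ : Par) (a : A) : Measurable (M.dens θ a) :=
  (M.measurable_dens θ).comp (measurable_const.prodMk measurable_id)

/-- The law under `θ'` has density `f_θ' / f_θ` with respect to the law under `θ`, provided that
`f_θ` is positive almost surely under `θ'`; the reference measure need not be σ-finite. -/
theorem obs_eq_withDensity {θ θ' : Par} {a : A}
    (h : ∀ᵐ x ∂(M.obs θ' a), 0 < M.dens θ a x) :
    M.obs θ' a = (M.obs θ a).withDensity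
      fun x => ENNReal.ofReal (M.dens θ' a x / M.dens θ a x) := by
  have hm := M.measurable_dens_apply θ a
  have hm' := M.measurable_dens_apply θ' a
  have hpos : MeasurableSet {x | 0 < M.dens θ a x} := measurableSet_lt measurable_const hm
  ext s hs
  have hq : Measurable
      (s.indicator fun x => ENNReal.ofReal (M.dens θ' a x / M.dens θ a x)) :=
    (hm'.div hm).ennreal_ofReal.indicator hs
  rw [withDensity_apply _ hs, M.obs_eq θ a, ← lintegral_indicator hs,
    lintegral_withDensity_eq_lintegral_mul _ hm.ennreal_ofReal hq]
  have hmeas : M.obs θ' a s = M.obs θ' a (s ∩ {x | 0 < M.dens θ a x}) := by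
    refine (measure_congr ?_)
    filter_upwards [h] with x hx
    exact propext ⟨fun hxs => ⟨hxs, hx⟩, fun hxs => hxs.1⟩
  rw [hmeas, M.obs_eq θ' a, withDensity_apply _ (hs.inter hpos),
    ← lintegral_indicator (hs.inter hpos)]
  refine lintegral_congr fun x => ?_
  by_cases hxs : x ∈ s
  · rcases (M.dens_nonneg θ a x).eq_or_lt with h0 | h0
    · simp [hxs, ← h0]
    · simp only [Set.indicator, Set.mem_inter_iff, hxs, Set.mem_ofPred_eq, h0, and_self, if_true,
        Pi.mul_apply]
      rw [← ENNReal.ofReal_mul h0.le, mul_div_cancel₀ _ h0.ne']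
  · simp [hxs]

variable {r : ℝ≥0}

theorem SubgaussianLLR.ae_pos (hsub : M.SubgaussianLLR r)
    {θ θ' : Par} (h : M.IsParam θ) (h' : M.IsParam θ') (a : A) :
    ∀ᵐ x ∂(M.obs θ a), 0 < M.dens θ' a x :=
  (hsub θ θ' θ' h h' h' a).1.mono fun _ hx => hx.1

theorem SubgaussianLLR.integrable_logLR (hsub : M.SubgaussianLLR r)
    {θ θ' θ'' : Par} (h : M.IsParam θ) (h' : M.IsParam θ')
    (h'' : M.IsParam θ'') (a : A) : Integrable (M.logLR θ' θ'' a) (M.obs θ a) := by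
  exact (integrable_add_const_iff (c := -∫ y, M.logLR θ' θ'' a y ∂(M.obs θ a))).1
    (hsub θ θ' θ'' h h' h'' a).2.integrable

theorem SubgaussianLLR.lintegral_exp_le (hsub : M.SubgaussianLLR r)
    {θ θ' θ'' : Par} (h : M.IsParam θ) (h' : M.IsParam θ')
    (h'' : M.IsParam θ'') (a : A) (l : ℝ) :
    ∫⁻ x, ENNReal.ofReal (Real.exp (l * M.logLR θ' θ'' a x)) ∂(M.obs θ a)
      ≤ ENNReal.ofReal (Real.exp (l * ∫ y, M.logLR θ' θ'' a y ∂(M.obs θ a) + r * l ^ 2 / 2)) := by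
  have hs := (hsub θ θ' θ'' h h' h'' a).2
  set m := ∫ y, M.logLR θ' θ'' a y ∂(M.obs θ a) with hm
  have h1 := hs.mgf_le l
  have h2 : ∫⁻ x, ENNReal.ofReal (Real.exp (l * (M.logLR θ' θ'' a x - m))) ∂(M.obs θ a)
      ≤ ENNReal.ofReal (Real.exp (r * l ^ 2 / 2)) := by
    rw [← ofReal_integral_eq_lintegral_ofReal (hs.integrable_exp_mul l)
      (ae_of_all _ fun x => (Real.exp_pos _).le)]
    exact ENNReal.ofReal_le_ofReal h1
  calc ∫⁻ x, ENNReal.ofReal (Real.exp (l * M.logLR θ' θ'' a x)) ∂(M.obs θ a)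
      = ∫⁻ x, ENNReal.ofReal (Real.exp (l * m)) *
          ENNReal.ofReal (Real.exp (l * (M.logLR θ' θ'' a x - m))) ∂(M.obs θ a) := by
        refine lintegral_congr fun x => ?_
        rw [← ENNReal.ofReal_mul (Real.exp_pos _).le, ← Real.exp_add]
        congr 2; ring
    _ ≤ ENNReal.ofReal (Real.exp (l * m)) * ENNReal.ofReal (Real.exp (r * l ^ 2 / 2)) := by
        rw [lintegral_const_mul' _ _ ENNReal.ofReal_ne_top]
        gcongr
    _ = _ := by rw [← ENNReal.ofReal_mul (Real.exp_pos _).le, ← Real.exp_add]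

theorem SubgaussianLLR.exp_logLR_ae (hsub : M.SubgaussianLLR r)
    {θ θ' : Par} (h : M.IsParam θ) (h' : M.IsParam θ') (a : A) :
    ∀ᵐ x ∂(M.obs θ a), Real.exp (M.logLR θ' θ a x) = M.dens θ' a x / M.dens θ a x := by
  filter_upwards [hsub.ae_pos h h a, hsub.ae_pos h h' a] with x hx hx'
  exact Real.exp_log (div_pos hx' hx)

theorem SubgaussianLLR.lintegral_exp_logLR (hsub : M.SubgaussianLLR r)
    {θ θ' : Par} (h : M.IsParam θ) (h' : M.IsParam θ')
    (a : A) : ∫⁻ x, ENNReal.ofReal (Real.exp (M.logLR θ' θ a x)) ∂(M.obs θ a) = 1 := by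
  have h1 := congrArg (fun μ => μ Set.univ) (obs_eq_withDensity (hsub.ae_pos h' h a))
  simp only [measure_univ, withDensity_apply _ MeasurableSet.univ, Measure.restrict_univ] at h1
  rw [h1]
  refine lintegral_congr_ae ?_
  filter_upwards [hsub.exp_logLR_ae h h' a] with x hx
  rw [hx]

theorem logLR_swap (θ θ' : Par) (a : A) (x : X) : M.logLR θ' θ a x = -M.logLR θ θ' a x := by
  rw [logLR, logLR, ← Real.log_inv, inv_div]

/-- Since `exp` of the log-likelihood ratio has mean one, subgaussianity bounds its drift: every
divergence of the model is at most `r / 2`. -/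
theorem SubgaussianLLR.integral_logLR_le (hsub : M.SubgaussianLLR r)
    {θ θ' : Par} (h : M.IsParam θ) (h' : M.IsParam θ')
    (a : A) : ∫ x, M.logLR θ θ' a x ∂(M.obs θ a) ≤ r / 2 := by
  have h1 := hsub.lintegral_exp_le h h h' a (-1)
  have h2 := hsub.lintegral_exp_logLR h h' a
  simp only [neg_one_mul, ← logLR_swap] at h1
  rw [h2, ← ENNReal.ofReal_one, ENNReal.ofReal_le_ofReal_iff (Real.exp_pos _).le] at h1
  have := Real.one_le_exp_iff.1 h1
  linarith

theorem SubgaussianLLR.obs_ac (hsub : M.SubgaussianLLR r)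
    {θ θ' : Par} (h : M.IsParam θ) (h' : M.IsParam θ') (a : A) :
    M.obs θ a ≪ M.obs θ' a := by
  rw [obs_eq_withDensity (hsub.ae_pos h h' a)]
  exact withDensity_absolutelyContinuous _ _

theorem SubgaussianLLR.llr_ae_eq (hsub : M.SubgaussianLLR r)
    {θ θ' : Par} (h : M.IsParam θ) (h' : M.IsParam θ') (a : A) :
    llr (M.obs θ a) (M.obs θ' a) =ᵐ[M.obs θ a] M.logLR θ θ' a := by
  have h1 : (M.obs θ a).rnDeriv (M.obs θ' a) =ᵐ[M.obs θ' a]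
      fun x => ENNReal.ofReal (M.dens θ a x / M.dens θ' a x) := by
    conv_lhs => rw [obs_eq_withDensity (hsub.ae_pos h h' a)]
    exact Measure.rnDeriv_withDensity _
      ((M.measurable_dens_apply θ a).div (M.measurable_dens_apply θ' a)).ennreal_ofReal
  filter_upwards [hsub.obs_ac h h' a h1] with x hx
  rw [llr, hx, logLR, ENNReal.toReal_ofReal (div_nonneg (M.dens_nonneg _ _ _)
    (M.dens_nonneg _ _ _))]

theorem SubgaussianLLR.toReal_kl (hsub : M.SubgaussianLLR r)
    {θ θ' : Par} (h : M.IsParam θ) (h' : M.IsParam θ') (a : A) :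
    (M.kl θ θ' a).toReal = ∫ x, M.logLR θ θ' a x ∂(M.obs θ a) := by
  rw [kl, toReal_klDiv_of_measure_eq (hsub.obs_ac h h' a) (by simp),
    integral_congr_ae (hsub.llr_ae_eq h h' a)]

theorem SubgaussianLLR.kl_ne_top (hsub : M.SubgaussianLLR r)
    {θ θ' : Par} (h : M.IsParam θ) (h' : M.IsParam θ') (a : A) :
    M.kl θ θ' a ≠ ∞ :=
  klDiv_ne_top (hsub.obs_ac h h' a)
    ((hsub.integrable_logLR h h h' a).congr (hsub.llr_ae_eq h h' a).symm)

theorem SubgaussianLLR.toReal_kl_le (hsub : M.SubgaussianLLR r)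
    {θ θ' : Par} (h : M.IsParam θ) (h' : M.IsParam θ') (a : A) :
    (M.kl θ θ' a).toReal ≤ r / 2 :=
  (hsub.toReal_kl h h' a).trans_le (hsub.integral_logLR_le h h' a)

/-- For `0 ≤ l ≤ 1` the `l`-th power of a likelihood ratio has mean at most one. -/
theorem SubgaussianLLR.lintegral_exp_neg_le_one (hsub : M.SubgaussianLLR r)
    {θ θ' : Par} (h : M.IsParam θ)
    (h' : M.IsParam θ') (a : A) {l : ℝ} (hl : 0 ≤ l) (hl1 : l ≤ 1) :
    ∫⁻ x, ENNReal.ofReal (Real.exp (-l * M.logLR θ θ' a x)) ∂(M.obs θ a) ≤ 1 := by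
  calc ∫⁻ x, ENNReal.ofReal (Real.exp (-l * M.logLR θ θ' a x)) ∂(M.obs θ a)
      ≤ ∫⁻ x, (ENNReal.ofReal (1 - l) +
          ENNReal.ofReal l * ENNReal.ofReal (Real.exp (M.logLR θ' θ a x))) ∂(M.obs θ a) := by
        refine lintegral_mono fun x => ?_
        rw [← ENNReal.ofReal_mul hl, ← ENNReal.ofReal_add (by linarith)
          (mul_nonneg hl (Real.exp_pos _).le)]
        refine ENNReal.ofReal_le_ofReal ?_
        have := convexOn_exp.2 (Set.mem_univ (0 : ℝ)) (Set.mem_univ (M.logLR θ' θ a x))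
          (show 0 ≤ 1 - l by linarith) hl (by ring)
        simp only [smul_eq_mul, mul_zero, zero_add, Real.exp_zero, mul_one] at this
        rwa [neg_mul, ← mul_neg, ← logLR_swap θ θ' a x]
    _ = 1 := by
        rw [lintegral_add_left measurable_const, lintegral_const_mul' _ _ ENNReal.ofReal_ne_top,
          hsub.lintegral_exp_logLR h h', lintegral_const, measure_univ, mul_one, mul_one,
          ← ENNReal.ofReal_add (by linarith) hl]
        simp

end BanditModel

/-! ### False alarms -/

namespace EpsGCD

open BanditModel

variable {Par A X : Type*} [MeasurableSpace A] [MeasurableSpace X] {M : BanditModel Par A X}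
  (G : EpsGCD M)

theorem measurable_exploitAfter (n : ℕ) :
    Measurable fun ω : ℕ → Round A X => M.exploitAfter ω n := by
  induction n with
  | zero => exact measurable_pi_lambda _ fun θ => by simp [exploitAfter]
  | succ n ih =>
    refine measurable_pi_lambda _ fun θ => ?_
    simp only [exploitAfter]
    have hn : Measurable fun ω : ℕ → Round A X => ω n := measurable_pi_apply n
    refine Measurable.max (((measurable_pi_apply θ).comp ih).add ?_) measurable_const
    refine Measurable.ite ?_ measurable_const ((M.measurable_logLR θ M.θ₀).comp hn.snd)
    exact hn.fst (measurableSet_singleton true)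

variable (M) in
/-- The exploitation statistic of `θ` has reached `log β` at some point of the first `n` rounds. -/
def crossed (β : ℝ) (θ : M.Θ₁) (n : ℕ) : Set (ℕ → Round A X) :=
  {ω | ∃ k ≤ n, Real.log β ≤ M.exploitAfter ω k θ}

theorem measurableSet_crossed (β : ℝ) (θ : M.Θ₁) (n : ℕ) : MeasurableSet (crossed M β θ n) := by
  have : crossed M β θ n = ⋃ k ∈ {k | k ≤ n}, {ω | Real.log β ≤ M.exploitAfter ω k θ} := by
    ext ω; simp [crossed]
  rw [this]
  exact MeasurableSet.biUnion (Set.to_countable _) fun k _ =>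
    measurableSet_le measurable_const ((measurable_pi_apply θ).comp (measurable_exploitAfter k))

/-- The factor by which the exponential of the exploitation statistic of `θ` changes in a round
before truncation. -/
noncomputable def exploitRatio (θ : M.Θ₁) (x : Round A X) : ℝ≥0∞ :=
  if x.1 = true then 1 else ENNReal.ofReal (Real.exp (M.logLR θ M.θ₀ x.2.1 x.2.2))

theorem measurable_exploitRatio (θ : M.Θ₁) : Measurable (exploitRatio (M := M) θ) :=
  Measurable.ite (measurable_fst (measurableSet_singleton true)) measurable_const
    (((M.measurable_logLR θ M.θ₀).comp measurable_snd).exp.ennreal_ofReal)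

theorem lintegral_exploitRatio {r : ℝ≥0} (hsub : M.SubgaussianLLR r) (θ : M.Θ₁)
    (q : M.Θ₁ → ℝ) : ∫⁻ x, exploitRatio θ x ∂(G.roundKernel M.θ₀ q) = 1 := by
  rw [G.lintegral_roundKernel _ _ (measurable_exploitRatio θ)]
  simp only [exploitRatio, if_true, Bool.false_eq_true, if_false,
    hsub.lintegral_exp_logLR isParam_pre (isParam_post θ), lintegral_const, measure_univ, mul_one]
  rw [← ENNReal.ofReal_add G.ε.2.1 (by linarith [G.ε.2.2])]
  simp

/-- The exponential of the exploitation statistic, stopped at `β` when it gets there, grows by at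
most one per round in the mean when there is no change. -/
theorem lintegral_stopped_le {r : ℝ≥0} (hsub : M.SubgaussianLLR r) (θ : M.Θ₁) {β : ℝ}
    (hβ : 0 < β) (n : ℕ) :
    ∫⁻ ω, (crossed M β θ n).indicator (fun _ => ENNReal.ofReal β) ω
      + (crossed M β θ n)ᶜ.indicator
        (fun ω => ENNReal.ofReal (Real.exp (M.exploitAfter ω n θ))) ω ∂(G.law M.noChange)
      ≤ (n + 1 : ℕ) := by
  induction n with
  | zero =>
    calc _ ≤ ∫⁻ ω, 1 ∂(G.law M.noChange) := by
          refine lintegral_mono fun ω => ?_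
          by_cases h : ω ∈ crossed M β θ 0
          · obtain ⟨k, hk, h'⟩ := id h
            obtain rfl : k = 0 := by omega
            have h2 : β ≤ 1 := (Real.log_nonpos_iff hβ.le).1 h'
            simpa [h] using h2
          · simp [h, exploitAfter]
      _ = _ := by simp
  | succ n ih =>
    set C := crossed M β θ n with hC
    have hCm : MeasurableSet C := measurableSet_crossed β θ n
    have hW : Measurable fun ω : ℕ → Round A X =>
        ENNReal.ofReal (Real.exp (M.exploitAfter ω n θ)) :=
      ((measurable_pi_apply θ).comp (measurable_exploitAfter n)).exp.ennreal_ofReal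
    let F : (ℕ → Round A X) → Round A X → ℝ≥0∞ := fun ω x =>
      (C.indicator (fun _ => ENNReal.ofReal β) ω + 1) + Cᶜ.indicator
        (fun ω => ENNReal.ofReal (Real.exp (M.exploitAfter ω n θ))) ω * exploitRatio θ x
    have hF : Measurable (Function.uncurry F) :=
      (((measurable_const.indicator hCm).add_const 1).comp measurable_fst).add
        (((hW.indicator hCm.compl).comp measurable_fst).mul
          ((measurable_exploitRatio θ).comp measurable_snd))
    have hFdep : ∀ x ω ω', (∀ i < n, ω i = ω' i) → F ω x = F ω' x := by
      intro x ω ω' h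
      have hCC : ω ∈ C ↔ ω' ∈ C := by
        simp only [hC, crossed, Set.mem_ofPred_eq]
        refine exists_congr fun k => and_congr_right fun hk => ?_
        rw [exploitAfter_congr fun i hi => h i (lt_of_lt_of_le hi hk)]
      by_cases h1 : ω ∈ C
      · simp [F, h1, hCC.1 h1]
      · simp [F, h1, mt hCC.2 h1, exploitAfter_congr h]
    calc _ ≤ ∫⁻ ω, F ω (ω n) ∂(G.law M.noChange) := by
          refine lintegral_mono fun ω => ?_
          by_cases h1 : ω ∈ C
          · have h2 : ω ∈ crossed M β θ (n + 1) := by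
              obtain ⟨k, hk, h⟩ := h1
              exact ⟨k, by omega, h⟩
            simp [F, h1, h2]
          · have hstep : ENNReal.ofReal (Real.exp (M.exploitAfter ω (n + 1) θ)) ≤ F ω (ω n) := by
              have h3 : F ω (ω n) = 1 +
                  ENNReal.ofReal (Real.exp (M.exploitAfter ω n θ)) * exploitRatio θ (ω n) := by
                simp [F, h1]
              rw [h3]
              simp only [exploitAfter, exploitRatio]
              rw [Real.exp_monotone.map_max, ENNReal.ofReal_mono.map_max, max_comm]
              refine (max_le_add_of_nonneg zero_le zero_le).trans ?_
              split_ifs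
              · simp
              · rw [Real.exp_add, ENNReal.ofReal_mul (Real.exp_pos _).le]
                simp
            refine le_trans ?_ hstep
            by_cases h2 : ω ∈ crossed M β θ (n + 1)
            · obtain ⟨k, hk, h⟩ := id h2
              have hkn : k = n + 1 := by
                by_contra hne
                exact h1 ⟨k, by omega, h⟩
              subst hkn
              simp only [h2, Set.indicator_of_mem, Set.mem_compl_iff, not_true_eq_false,
                not_false_eq_true, Set.indicator_of_notMem, add_zero]
              exact ENNReal.ofReal_le_ofReal ((Real.log_le_iff_le_exp hβ).1 h)
            · simp [h2]
      _ = _ := G.lintegral_law_step M.noChange n hF hFdep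
      _ = ∫⁻ ω, (C.indicator (fun _ => ENNReal.ofReal β) ω
            + Cᶜ.indicator (fun ω => ENNReal.ofReal (Real.exp (M.exploitAfter ω n θ))) ω) + 1
            ∂(G.law M.noChange) := by
          refine lintegral_congr fun ω => ?_
          simp only [F, noChange]
          rw [lintegral_add_left measurable_const,
            lintegral_const_mul _ (measurable_exploitRatio θ), G.lintegral_exploitRatio hsub,
            lintegral_const, measure_univ, mul_one, mul_one]
          ring
      _ ≤ _ := by
          rw [lintegral_add_right _ measurable_const, lintegral_const, measure_univ, mul_one]
          push_cast at ih ⊢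
          gcongr

theorem measure_crossed_le {r : ℝ≥0} (hsub : M.SubgaussianLLR r) (θ : M.Θ₁) {β : ℝ}
    (hβ : 0 < β) (n : ℕ) :
    G.law M.noChange (crossed M β θ n) ≤ ENNReal.ofReal ((n + 1) / β) := by
  have h1 : ENNReal.ofReal β * G.law M.noChange (crossed M β θ n) ≤ (n + 1 : ℕ) := by
    refine le_trans ?_ (G.lintegral_stopped_le hsub θ hβ n)
    rw [← lintegral_indicator_const (measurableSet_crossed β θ n)]
    exact lintegral_mono fun ω => le_self_add
  rw [ENNReal.ofReal_div_of_pos hβ, ENNReal.le_div_iff_mul_le (by simp [hβ]) (by simp), mul_comm]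
  refine h1.trans (le_of_eq ?_)
  rw [← ENNReal.ofReal_natCast]; push_cast; rfl

theorem stopTime_lt_iff {β : ℝ} {ω : ℕ → Round A X} {m : ℕ} :
    M.stopTime β ω < m ↔
      ∃ t, 1 ≤ t ∧ t < m ∧ ∃ θ : M.Θ₁, Real.log β ≤ M.exploitAfter ω (t - 1) θ := by
  simp only [stopTime, iInf_lt_iff, Set.mem_ofPred_eq, Q2, Nat.cast_lt]
  constructor
  · rintro ⟨t, ⟨h1, h2⟩, h3⟩; exact ⟨t, h1, h3, h2⟩
  · rintro ⟨t, h1, h3, h2⟩; exact ⟨t, ⟨h1, h2⟩, h3⟩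

/-- The probability of a false alarm before round `m`. -/
theorem measure_stopTime_lt_le {r : ℝ≥0} (hsub : M.SubgaussianLLR r) {α β : ℝ} {m : ℕ}
    (hα : 0 < α) (hβ : (m * M.Θ₁.card : ℝ) / α ≤ β) :
    G.law M.noChange {ω | M.stopTime β ω < m} ≤ ENNReal.ofReal α := by
  rcases Nat.lt_or_ge m 2 with hm | hm
  · have : {ω : ℕ → Round A X | M.stopTime β ω < m} = ∅ := by
      ext ω
      simp only [Set.mem_ofPred_eq, stopTime_lt_iff, Set.mem_empty_iff_false, iff_false]
      rintro ⟨t, h1, h2, -⟩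
      omega
    simp [this]
  have hΘ : 0 < M.Θ₁.card := Finset.card_pos.2 ⟨_, (G.select fun _ => 0).2⟩
  have hm0 : (0 : ℝ) < m := by exact_mod_cast (by omega : 0 < m)
  have hΘ0 : (0 : ℝ) < M.Θ₁.card := by exact_mod_cast hΘ
  have hβ0 : 0 < β := lt_of_lt_of_le (by positivity) hβ
  calc G.law M.noChange {ω | M.stopTime β ω < m}
      ≤ G.law M.noChange (⋃ θ : M.Θ₁, crossed M β θ (m - 2)) := by
        refine measure_mono fun ω hω => ?_
        obtain ⟨t, h1, h2, θ, h3⟩ := stopTime_lt_iff.1 hω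
        exact Set.mem_iUnion.2 ⟨θ, t - 1, by omega, h3⟩
    _ ≤ ∑ θ : M.Θ₁, G.law M.noChange (crossed M β θ (m - 2)) := measure_iUnion_fintype_le _ _
    _ ≤ ∑ θ : M.Θ₁, ENNReal.ofReal (α / M.Θ₁.card) := by
        refine Finset.sum_le_sum fun θ _ => (G.measure_crossed_le hsub θ hβ0 _).trans
          (ENNReal.ofReal_le_ofReal ?_)
        rw [div_le_iff₀ hα] at hβ
        rw [div_le_div_iff₀ hβ0 hΘ0]
        have : ((m - 2 : ℕ) : ℝ) + 1 ≤ m := by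
          rw [Nat.cast_sub hm]; push_cast; linarith
        nlinarith
    _ = ENNReal.ofReal α := by
        rw [Finset.sum_const, Finset.card_univ, Fintype.card_coe, nsmul_eq_mul,
          ← ENNReal.ofReal_natCast, ← ENNReal.ofReal_mul hΘ0.le, mul_div_cancel₀ _ hΘ0.ne']

/-! ### Integrability of the exploration statistics before the change -/

theorem exploreAfter_nonneg (ω : ℕ → Round A X) (n : ℕ) (θ : M.Θ₁) :
    0 ≤ M.exploreAfter ω n θ := by
  cases n with
  | zero => exact le_rfl
  | succ n => exact le_max_right _ _

/-- The positive part of a log-likelihood ratio is at most the likelihood ratio, whose mean is one;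
no bound on the divergences from the pre-change parameter is involved. -/
theorem lintegral_exploreAfter_le {r : ℝ≥0} (hsub : M.SubgaussianLLR r) (n : ℕ) (θ : M.Θ₁) :
    ∫⁻ ω, ENNReal.ofReal (M.exploreAfter ω n θ) ∂(G.law M.noChange) ≤ n := by
  induction n with
  | zero => simp [exploreAfter]
  | succ n ih =>
    have hu : Measurable fun x : Round A X =>
        ENNReal.ofReal (Real.exp (M.logLR θ M.θ₀ x.2.1 x.2.2)) :=
      ((M.measurable_logLR θ M.θ₀).comp measurable_snd).exp.ennreal_ofReal
    let F : (ℕ → Round A X) → Round A X → ℝ≥0∞ := fun ω x =>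
      ENNReal.ofReal (M.exploreAfter ω n θ)
        + ENNReal.ofReal (Real.exp (M.logLR θ M.θ₀ x.2.1 x.2.2))
    have hq : Measurable fun ω : ℕ → Round A X => ENNReal.ofReal (M.exploreAfter ω n θ) :=
      ((measurable_pi_apply θ).comp (M.measurable_exploreAfter n)).ennreal_ofReal
    have hF : Measurable (Function.uncurry F) :=
      (hq.comp measurable_fst).add (hu.comp measurable_snd)
    calc _ ≤ ∫⁻ ω, F ω (ω n) ∂(G.law M.noChange) := by
          refine lintegral_mono fun ω => ?_
          simp only [F, exploreAfter]
          have h0 := exploreAfter_nonneg ω n θ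
          rw [← ENNReal.ofReal_add h0 (Real.exp_pos _).le]
          refine ENNReal.ofReal_le_ofReal (max_le ?_ (by positivity))
          have := Real.add_one_le_exp (M.logLR θ M.θ₀ (ω n).2.1 (ω n).2.2)
          have := Real.exp_pos (M.logLR θ M.θ₀ (ω n).2.1 (ω n).2.2)
          split_ifs <;> linarith
      _ = _ := G.lintegral_law_step M.noChange n hF fun x ω ω' h => by
          simp only [F, exploreAfter_congr h]
      _ = ∫⁻ ω, ENNReal.ofReal (M.exploreAfter ω n θ) + 1 ∂(G.law M.noChange) := by
          refine lintegral_congr fun ω => ?_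
          simp only [F, noChange]
          rw [lintegral_add_left measurable_const, lintegral_const, measure_univ, mul_one,
            G.lintegral_roundKernel _ _ hu]
          simp only [hsub.lintegral_exp_logLR isParam_pre (isParam_post θ), lintegral_const,
            measure_univ, mul_one]
          rw [← ENNReal.ofReal_add G.ε.2.1 (by linarith [G.ε.2.2])]
          simp
      _ ≤ _ := by
          rw [lintegral_add_right _ measurable_const, lintegral_const, measure_univ, mul_one]
          push_cast
          gcongr

theorem integrable_Q1 {r : ℝ≥0} (hsub : M.SubgaussianLLR r) (t : ℕ) (θ : M.Θ₁) :
    Integrable (fun ω => M.Q1 ω t θ) (G.law M.noChange) := by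
  refine ⟨((measurable_pi_apply θ).comp
    (M.measurable_exploreAfter (t - 1))).aestronglyMeasurable, ?_⟩
  rw [hasFiniteIntegral_iff_ofReal (ae_of_all _ fun ω =>
    show 0 ≤ M.Q1 ω t θ from exploreAfter_nonneg ω _ θ)]
  exact (G.lintegral_exploreAfter_le hsub (t - 1) θ).trans_lt (ENNReal.natCast_lt_top _)

end EpsGCD

/-! ### Hoeffding's lemma and exponential series -/

/-- Hoeffding's lemma in terms of the lower integral. -/
theorem lintegral_exp_sub_integral_le {μ : Measure ℝ} [IsProbabilityMeasure μ] {b : ℝ≥0}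
    (hb : ∀ᵐ y ∂μ, y ∈ Set.Icc (-b : ℝ) b) (l : ℝ) :
    ∫⁻ y, ENNReal.ofReal (Real.exp (l * (y - ∫ z, z ∂μ))) ∂μ
      ≤ ENNReal.ofReal (Real.exp (b ^ 2 * l ^ 2 / 2)) := by
  have h := hasSubgaussianMGF_of_mem_Icc (μ := μ) (X := fun y : ℝ => y) aemeasurable_id hb
  rw [← ofReal_integral_eq_lintegral_ofReal (h.integrable_exp_mul l)
    (ae_of_all _ fun x => (Real.exp_pos _).le)]
  refine ENNReal.ofReal_le_ofReal ((h.mgf_le l).trans (le_of_eq ?_))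
  have h2 : (‖(b : ℝ) - -(b : ℝ)‖₊ / 2) ^ 2 = b ^ 2 := by
    congr 1
    ext
    simp [abs_of_nonneg (show (0 : ℝ) ≤ b + b by positivity)]
  rw [h2]
  push_cast
  rfl

theorem tsum_indicator_le_ofReal {y : ℝ} (hy : 0 ≤ y) :
    ∑' n : ℕ, (if 1 ≤ n ∧ (n : ℝ) ≤ y then 1 else 0 : ℝ≥0∞) ≤ ENNReal.ofReal y := by
  rw [tsum_eq_sum (s := Finset.Icc 1 ⌊y⌋₊)]
  · calc ∑ n ∈ Finset.Icc 1 ⌊y⌋₊, (if 1 ≤ n ∧ (n : ℝ) ≤ y then 1 else 0 : ℝ≥0∞)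
        ≤ ∑ n ∈ Finset.Icc 1 ⌊y⌋₊, 1 :=
          Finset.sum_le_sum fun n _ => by split_ifs <;> simp
      _ = (⌊y⌋₊ : ℝ≥0∞) := by simp
      _ ≤ ENNReal.ofReal y := by
          rw [← ENNReal.ofReal_natCast]
          exact ENNReal.ofReal_le_ofReal (Nat.floor_le hy)
  · intro n hn
    refine if_neg fun h => hn (Finset.mem_Icc.2 ⟨h.1, Nat.le_floor h.2⟩)

theorem inv_one_sub_exp_neg_le {y : ℝ} (hy : 0 < y) : (1 - Real.exp (-y))⁻¹ ≤ 1 + 1 / y := by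
  have h1 : Real.exp (-y) ≤ (1 + y)⁻¹ := by
    rw [Real.exp_neg]
    exact inv_anti₀ (by linarith) (by linarith [Real.add_one_le_exp y])
  have h2 : 0 < y / (1 + y) := by positivity
  have h3 : y / (1 + y) ≤ 1 - Real.exp (-y) := by
    have : y / (1 + y) = 1 - (1 + y)⁻¹ := by field_simp; ring
    linarith
  refine (inv_anti₀ h2 h3).trans (le_of_eq ?_)
  field_simp
  ring

theorem exp_neg_le_one_sub_half {x : ℝ} (h0 : 0 ≤ x) (h1 : x ≤ 1) :
    Real.exp (-x) ≤ 1 - x / 2 := by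
  have h2 : Real.exp (-x) ≤ (1 + x)⁻¹ := by
    rw [Real.exp_neg]
    exact inv_anti₀ (by linarith) (by linarith [Real.add_one_le_exp x])
  refine h2.trans ?_
  rw [inv_le_iff_one_le_mul₀ (by linarith)]
  nlinarith

theorem tsum_exp_neg_le {y : ℝ} (hy : 0 < y) :
    ∑' n : ℕ, ENNReal.ofReal (Real.exp (-(n * y))) ≤ ENNReal.ofReal (1 + 1 / y) := by
  have hq : Real.exp (-y) < 1 := by simpa using hy
  have h := hasSum_geometric_of_lt_one (Real.exp_pos (-y)).le hq
  have h1 : ∀ n : ℕ, Real.exp (-(n * y)) = Real.exp (-y) ^ n := fun n => by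
    rw [← Real.exp_nat_mul]; ring_nf
  simp only [h1]
  rw [← ENNReal.ofReal_tsum_of_nonneg (fun n => by positivity) h.summable, h.tsum_eq]
  exact ENNReal.ofReal_le_ofReal (inv_one_sub_exp_neg_le hy)

theorem tsum_succ_mul_exp_neg_le {y : ℝ} (hy : 0 < y) :
    ∑' n : ℕ, ENNReal.ofReal ((n + 1) * Real.exp (-(n * y)))
      ≤ ENNReal.ofReal ((1 + 1 / y) ^ 2) := by
  have hq : Real.exp (-y) < 1 := by simpa using hy
  have h := hasSum_choose_mul_geometric_of_norm_lt_one (r := Real.exp (-y)) 1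
    (by rwa [Real.norm_of_nonneg (Real.exp_pos _).le])
  have h1 : ∀ n : ℕ, (n + 1) * Real.exp (-(n * y))
      = ((n + 1).choose 1 : ℝ) * Real.exp (-y) ^ n := fun n => by
    rw [← Real.exp_nat_mul, Nat.choose_one_right]
    push_cast
    ring_nf
  simp only [h1]
  rw [← ENNReal.ofReal_tsum_of_nonneg (fun n => by positivity) h.summable, h.tsum_eq]
  refine ENNReal.ofReal_le_ofReal ?_
  rw [one_div, ← inv_pow]
  have : 0 ≤ (1 - Real.exp (-y))⁻¹ := inv_nonneg.2 (by linarith)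
  exact pow_le_pow_left₀ this (inv_one_sub_exp_neg_le hy) 2

/-! ### Concentration of the exploration statistics -/

namespace EpsGCD

open BanditModel

variable {Par A X : Type*} [MeasurableSpace A] [MeasurableSpace X] {M : BanditModel Par A X}
  (G : EpsGCD M)

theorem measurable_integral_logLR (θ θ' θ'' : Par) :
    Measurable fun a => ∫ x, M.logLR θ' θ'' a x ∂(M.obs θ a) :=
  (StronglyMeasurable.integral_kernel_prod_right' (κ := M.obs θ)
    (M.measurable_logLR θ' θ'').stronglyMeasurable).measurable

theorem measurable_kl {r : ℝ≥0} (hsub : M.SubgaussianLLR r) {θ θ' : Par} (h : M.IsParam θ)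
    (h' : M.IsParam θ') : Measurable (M.kl θ θ') := by
  have : M.kl θ θ' = fun a => ENNReal.ofReal (∫ x, M.logLR θ θ' a x ∂(M.obs θ a)) := by
    funext a
    rw [← hsub.toReal_kl h h', ENNReal.ofReal_toReal (hsub.kl_ne_top h h' a)]
  rw [this]
  exact (measurable_integral_logLR θ θ θ').ennreal_ofReal

theorem integrable_toReal_kl {r : ℝ≥0} (hsub : M.SubgaussianLLR r) {θ θ' : Par}
    (h : M.IsParam θ) (h' : M.IsParam θ') :
    Integrable (fun a => (M.kl θ θ' a).toReal) G.π :=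
  Integrable.of_mem_Icc 0 (r / 2) (measurable_kl hsub h h').ennreal_toReal.aemeasurable
    (ae_of_all _ fun a => ⟨ENNReal.toReal_nonneg, hsub.toReal_kl_le h h' a⟩)

theorem avgKL_eq_integral {r : ℝ≥0} (hsub : M.SubgaussianLLR r) {θ θ' : Par}
    (h : M.IsParam θ) (h' : M.IsParam θ') :
    G.avgKL θ θ' = ∫ a, (M.kl θ θ' a).toReal ∂G.π :=
  (integral_toReal (measurable_kl hsub h h').aemeasurable
    (ae_of_all _ fun a => (hsub.kl_ne_top h h' a).lt_top)).symm

theorem integral_logLR_eq_sub {r : ℝ≥0} (hsub : M.SubgaussianLLR r) (θs θ : M.Θ₁) (a : A) :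
    ∫ x, M.logLR θ M.θ₀ a x ∂(M.obs θs a)
      = (M.kl θs M.θ₀ a).toReal - (M.kl θs θ a).toReal := by
  have hs := isParam_post θs
  have hθ := isParam_post θ
  have h0 : M.IsParam M.θ₀ := isParam_pre
  rw [hsub.toReal_kl hs h0, hsub.toReal_kl hs hθ,
    ← integral_sub (hsub.integrable_logLR hs hs h0 a) (hsub.integrable_logLR hs hs hθ a)]
  refine integral_congr_ae ?_
  filter_upwards [hsub.ae_pos hs hs a, hsub.ae_pos hs hθ a, hsub.ae_pos hs h0 a] with x h1 h2 h3
  simp only [logLR]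
  rw [Real.log_div h2.ne' h3.ne', Real.log_div h1.ne' h3.ne', Real.log_div h1.ne' h2.ne']
  ring

/-- The increment of the exploration statistic of `θ` in a round, before truncation. -/
noncomputable def exploreIncr (θ : M.Θ₁) (x : Round A X) : ℝ :=
  if x.1 = true then M.logLR θ M.θ₀ x.2.1 x.2.2 else 0

theorem measurable_exploreIncr (θ : M.Θ₁) : Measurable (exploreIncr (M := M) θ) :=
  Measurable.ite (measurable_fst (measurableSet_singleton true))
    ((M.measurable_logLR θ M.θ₀).comp measurable_snd) measurable_const

/-- The mean of the exploration increment of `θ` when the parameter in force is `θs`. -/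
noncomputable def exploreMean (θs θ : M.Θ₁) : ℝ :=
  G.ε * (G.avgKL θs M.θ₀ - G.avgKL θs θ)

/-- The centred exploration increment is subgaussian: the log-likelihood ratio contributes `r`,
and the choice of the action, which moves the conditional mean within `[-r/2, r/2]`, contributes
`(r/2)²`. -/
theorem lintegral_exp_exploreIncr_le {r : ℝ≥0} (hsub : M.SubgaussianLLR r) (θs θ : M.Θ₁)
    (q : M.Θ₁ → ℝ) (l : ℝ) :
    ∫⁻ x, ENNReal.ofReal (Real.exp (l * (exploreIncr θ x - G.exploreMean θs θ)))
        ∂(G.roundKernel θs q)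
      ≤ ENNReal.ofReal (Real.exp ((r + (r / 2) ^ 2) * l ^ 2 / 2)) := by
  set m := G.exploreMean θs θ with hm
  set h : A → ℝ := fun a => ∫ x, M.logLR θ M.θ₀ a x ∂(M.obs θs a) with hh
  have hhm : Measurable h := measurable_integral_logLR _ _ _
  have hs := isParam_post θs
  have hθ := isParam_post θ
  have h0 : M.IsParam M.θ₀ := isParam_pre
  have hε := G.ε.2.1
  have hε1 : 0 ≤ 1 - (G.ε : ℝ) := by linarith [G.ε.2.2]
  have hhr : ∀ a, h a ∈ Set.Icc (-(r / 2 : ℝ≥0) : ℝ) (r / 2 : ℝ≥0) := by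
    intro a
    simp only [hh, integral_logLR_eq_sub hsub]
    push_cast
    have h1 := hsub.toReal_kl_le hs h0 a
    have h2 := hsub.toReal_kl_le hs hθ a
    have h3 : 0 ≤ (M.kl θs M.θ₀ a).toReal := ENNReal.toReal_nonneg
    have h4 : 0 ≤ (M.kl θs θ a).toReal := ENNReal.toReal_nonneg
    constructor <;> linarith
  -- `μ` is the law of the conditional mean of the increment given the action
  let μ : Measure ℝ := ENNReal.ofReal G.ε • G.π.map h + ENNReal.ofReal (1 - G.ε) • Measure.dirac 0
  have hmapP : IsProbabilityMeasure (G.π.map h) := Measure.isProbabilityMeasure_map hhm.aemeasurable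
  have hμ : IsProbabilityMeasure μ := ⟨by
    simp only [μ, Measure.add_apply, Measure.smul_apply, measure_univ, smul_eq_mul, mul_one]
    rw [← ENNReal.ofReal_add hε hε1]
    simp⟩
  have hint : Integrable h G.π := Integrable.of_mem_Icc _ _ hhm.aemeasurable (ae_of_all _ hhr)
  have hmean : ∫ z, z ∂μ = m := by
    have hi1 : Integrable (fun z : ℝ => z) (G.π.map h) :=
      (integrable_map_measure (by fun_prop) hhm.aemeasurable).2 hint
    rw [integral_add_measure (hi1.smul_measure (by simp))
      ((integrable_dirac (by simp)).smul_measure (by simp)), integral_smul_measure,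
      integral_smul_measure, integral_map hhm.aemeasurable (by fun_prop), integral_dirac,
      ENNReal.toReal_ofReal hε]
    simp only [smul_eq_mul, mul_zero, add_zero, hh, integral_logLR_eq_sub hsub]
    rw [integral_sub (G.integrable_toReal_kl hsub hs h0) (G.integrable_toReal_kl hsub hs hθ),
      ← G.avgKL_eq_integral hsub hs h0, ← G.avgKL_eq_integral hsub hs hθ, hm, exploreMean]
  have hHoeff := lintegral_exp_sub_integral_le (μ := μ) (b := r / 2) (by
    rw [ae_add_measure_iff]
    refine ⟨Measure.ae_smul_measure ((ae_map_iff hhm.aemeasurable measurableSet_Icc).2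
      (ae_of_all _ hhr)) _, Measure.ae_smul_measure ?_ _⟩
    exact (ae_dirac_iff (p := fun y : ℝ => y ∈ Set.Icc (-(r / 2 : ℝ≥0) : ℝ) (r / 2 : ℝ≥0))
      measurableSet_Icc).2 (by simp; positivity)) l
  rw [hmean, lintegral_add_measure, lintegral_smul_measure, lintegral_smul_measure,
    lintegral_map (by fun_prop) hhm, lintegral_dirac] at hHoeff
  rw [G.lintegral_roundKernel _ _ (((((measurable_exploreIncr θ).sub_const m).const_mul
    l).exp).ennreal_ofReal)]
  simp only [exploreIncr, if_true, Bool.false_eq_true, if_false, lintegral_const, measure_univ,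
    mul_one]
  have hin : ∀ a, ∫⁻ x, ENNReal.ofReal (Real.exp (l * (M.logLR θ M.θ₀ a x - m))) ∂(M.obs θs a)
      ≤ ENNReal.ofReal (Real.exp (r * l ^ 2 / 2)) *
        ENNReal.ofReal (Real.exp (l * (h a - m))) := by
    intro a
    calc _ = ∫⁻ x, ENNReal.ofReal (Real.exp (-(l * m))) *
            ENNReal.ofReal (Real.exp (l * M.logLR θ M.θ₀ a x)) ∂(M.obs θs a) := by
          refine lintegral_congr fun x => ?_
          rw [← ENNReal.ofReal_mul (Real.exp_pos _).le, ← Real.exp_add]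
          congr 2; ring
      _ ≤ ENNReal.ofReal (Real.exp (-(l * m))) *
            ENNReal.ofReal (Real.exp (l * h a + r * l ^ 2 / 2)) := by
          rw [lintegral_const_mul' _ _ ENNReal.ofReal_ne_top]
          gcongr
          exact hsub.lintegral_exp_le hs hθ h0 a l
      _ = _ := by
          rw [← ENNReal.ofReal_mul (Real.exp_pos _).le, ← ENNReal.ofReal_mul (Real.exp_pos _).le,
            ← Real.exp_add, ← Real.exp_add]
          congr 2; ring
  have hone : 1 ≤ ENNReal.ofReal (Real.exp (r * l ^ 2 / 2)) := by
    rw [ENNReal.one_le_ofReal]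
    exact Real.one_le_exp (by positivity)
  calc _ ≤ ENNReal.ofReal G.ε * (ENNReal.ofReal (Real.exp (r * l ^ 2 / 2)) *
          ∫⁻ a, ENNReal.ofReal (Real.exp (l * (h a - m))) ∂G.π)
        + ENNReal.ofReal (1 - G.ε) * (ENNReal.ofReal (Real.exp (r * l ^ 2 / 2)) *
          ENNReal.ofReal (Real.exp (l * (0 - m)))) := by
        gcongr
        · exact (lintegral_mono hin).trans_eq (lintegral_const_mul' _ _ ENNReal.ofReal_ne_top)
        · exact le_mul_of_one_le_left' hone
    _ = ENNReal.ofReal (Real.exp (r * l ^ 2 / 2)) *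
          (ENNReal.ofReal G.ε * ∫⁻ a, ENNReal.ofReal (Real.exp (l * (h a - m))) ∂G.π
          + ENNReal.ofReal (1 - G.ε) * ENNReal.ofReal (Real.exp (l * (0 - m)))) := by ring
    _ ≤ ENNReal.ofReal (Real.exp (r * l ^ 2 / 2)) *
          ENNReal.ofReal (Real.exp ((r / 2 : ℝ≥0) ^ 2 * l ^ 2 / 2)) := by
        gcongr
        exact hHoeff
    _ = _ := by
        rw [← ENNReal.ofReal_mul (Real.exp_pos _).le, ← Real.exp_add]
        congr 2; push_cast; ring

/-- Chernoff's bound for the sum of the centred exploration increments over the rounds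
`k + 1, …, n`, multiplied by a sign `σ`. -/
theorem measure_sum_exploreIncr_ge_le {r : ℝ≥0} (hsub : M.SubgaussianLLR r) {sched : ℕ → Par}
    (θs θ : M.Θ₁) {k n : ℕ} (hs : ∀ s, k ≤ s → s < n → sched (s + 1) = θs)
    {σ γ c N : ℝ} (hσ : σ ^ 2 = 1) (hγ : (r + (r / 2) ^ 2 : ℝ) ≤ γ) (hγ0 : 0 < γ) (hN : 0 < N)
    (hc : 0 ≤ c) (hkn : ((n - k : ℕ) : ℝ) ≤ N) :
    G.law sched {ω | c ≤ σ * ∑ s ∈ Finset.Ico k n, (exploreIncr θ (ω s) - G.exploreMean θs θ)}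
      ≤ ENNReal.ofReal (Real.exp (-(c ^ 2 / (2 * γ * N)))) := by
  set m := G.exploreMean θs θ
  set l := σ * (c / (γ * N)) with hl
  let u : (M.Θ₁ → ℝ) → Round A X → ℝ≥0∞ := fun _ x =>
    ENNReal.ofReal (Real.exp (l * (exploreIncr θ x - m) - γ * l ^ 2 / 2))
  have hincr := measurable_exploreIncr (M := M) θ
  have hu : Measurable (Function.uncurry u) := by
    have : Measurable fun x : Round A X =>
        ENNReal.ofReal (Real.exp (l * (exploreIncr θ x - m) - γ * l ^ 2 / 2)) :=
      ((((hincr.sub_const m).const_mul l).sub_const _).exp).ennreal_ofReal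
    exact this.comp measurable_snd
  have hu1 : ∀ q, ∫⁻ x, u q x ∂(G.roundKernel θs q) ≤ 1 := by
    intro q
    calc ∫⁻ x, u q x ∂(G.roundKernel θs q)
        = ∫⁻ x, ENNReal.ofReal (Real.exp (-(γ * l ^ 2 / 2))) *
            ENNReal.ofReal (Real.exp (l * (exploreIncr θ x - m))) ∂(G.roundKernel θs q) := by
          refine lintegral_congr fun x => ?_
          rw [← ENNReal.ofReal_mul (Real.exp_pos _).le, ← Real.exp_add]
          simp only [u]
          congr 2; ring
      _ ≤ ENNReal.ofReal (Real.exp (-(γ * l ^ 2 / 2))) *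
            ENNReal.ofReal (Real.exp ((r + (r / 2) ^ 2) * l ^ 2 / 2)) := by
          rw [lintegral_const_mul' _ _ ENNReal.ofReal_ne_top]
          gcongr
          exact G.lintegral_exp_exploreIncr_le hsub θs θ q l
      _ ≤ 1 := by
          rw [← ENNReal.ofReal_mul (Real.exp_pos _).le, ← Real.exp_add, ENNReal.ofReal_le_one,
            Real.exp_le_one_iff]
          nlinarith [sq_nonneg l]
  have hprod := G.lintegral_prod_le_one sched hs hu hu1
  set E : Set (ℕ → Round A X) :=
    {ω | c ≤ σ * ∑ s ∈ Finset.Ico k n, (exploreIncr θ (ω s) - m)} with hE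
  have hEm : MeasurableSet E := measurableSet_le measurable_const
    ((Finset.measurable_fun_sum _ fun s _ =>
      (hincr.comp (measurable_pi_apply s)).sub_const m).const_mul σ)
  calc G.law sched E = ∫⁻ ω, E.indicator 1 ω ∂(G.law sched) := (lintegral_indicator_one hEm).symm
    _ ≤ ∫⁻ ω, ENNReal.ofReal (Real.exp (-(c ^ 2 / (2 * γ * N)))) *
          ∏ s ∈ Finset.Ico k n, u (M.exploreAfter ω s) (ω s) ∂(G.law sched) := by
        refine lintegral_mono fun ω => ?_
        by_cases hω : ω ∈ E
        · simp only [Set.indicator_of_mem hω, Pi.one_apply, u]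
          rw [← ENNReal.ofReal_prod_of_nonneg fun _ _ => (Real.exp_pos _).le, ← Real.exp_sum,
            ← ENNReal.ofReal_mul (Real.exp_pos _).le, ← Real.exp_add, ENNReal.one_le_ofReal]
          refine Real.one_le_exp ?_
          rw [Finset.sum_sub_distrib, ← Finset.mul_sum, Finset.sum_const, Nat.card_Ico,
            nsmul_eq_mul]
          have h1 : c ≤ σ * ∑ s ∈ Finset.Ico k n, (exploreIncr θ (ω s) - m) := hω
          set S := ∑ s ∈ Finset.Ico k n, (exploreIncr θ (ω s) - m)
          have hl2 : l ^ 2 = (c / (γ * N)) ^ 2 := by rw [hl, mul_pow, hσ, one_mul]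
          rw [hl2]
          have h2 : c * (c / (γ * N)) ≤ l * S := by
            rw [hl]
            have : 0 ≤ c / (γ * N) := by positivity
            nlinarith
          have h3 : ((n - k : ℕ) : ℝ) * (γ * (c / (γ * N)) ^ 2 / 2)
              ≤ N * (γ * (c / (γ * N)) ^ 2 / 2) := by gcongr
          have h4 : N * (γ * (c / (γ * N)) ^ 2 / 2) = c ^ 2 / (2 * γ * N) := by field_simp
          have h5 : c * (c / (γ * N)) = 2 * (c ^ 2 / (2 * γ * N)) := by field_simp
          linarith
        · simp [hω]
    _ ≤ _ := by
        rw [lintegral_const_mul' _ _ ENNReal.ofReal_ne_top]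
        exact mul_le_of_le_one_right' hprod

theorem sum_exploreIncr_le_exploreAfter (ω : ℕ → Round A X) (θ : M.Θ₁) (k n : ℕ) :
    ∑ s ∈ Finset.Ico k (k + n), exploreIncr θ (ω s) ≤ M.exploreAfter ω (k + n) θ := by
  induction n with
  | zero => simpa using exploreAfter_nonneg ω k θ
  | succ n ih =>
    rw [← add_assoc, Finset.sum_Ico_succ_top (by omega)]
    refine le_trans ?_ (le_max_left _ _)
    simpa [exploreIncr] using ih

/-- A CUSUM statistic is at most its initial value plus the largest sum of final increments. -/
theorem exploreAfter_le_add_sum (ω : ℕ → Round A X) (θ : M.Θ₁) (k n : ℕ) :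
    ∃ j ≤ n, M.exploreAfter ω (k + n) θ
      ≤ M.exploreAfter ω k θ + ∑ s ∈ Finset.Ico (k + j) (k + n), exploreIncr θ (ω s) := by
  induction n with
  | zero => exact ⟨0, le_rfl, by simp⟩
  | succ n ih =>
    obtain ⟨j, hj, h⟩ := ih
    have h0 := exploreAfter_nonneg ω k θ
    rcases le_total (M.exploreAfter ω (k + n) θ + exploreIncr θ (ω (k + n))) 0 with hle | hle
    · refine ⟨n + 1, le_rfl, ?_⟩
      rw [Finset.Ico_self, Finset.sum_empty, add_zero]
      exact (max_eq_right hle).trans_le h0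
    · refine ⟨j, by omega, ?_⟩
      rw [← add_assoc, Finset.sum_Ico_succ_top (by omega)]
      refine (max_eq_left hle).trans_le ?_
      linarith

theorem gap_eq (θs θ : Par) : G.gap θs θ
    = min (G.avgKL θs M.θ₀) (G.avgKL θs θ) / 2 := by
  have h : 0 ≤ G.avgKL θs θ := ENNReal.toReal_nonneg
  rw [gap]
  rcases le_total (G.avgKL θs M.θ₀) (G.avgKL θs θ) with h1 | h1
  · rw [min_eq_left h1, max_eq_right (by linarith)]; ring
  · rw [min_eq_right h1, max_eq_left (by linarith)]; ring

/-- If `θ` is ahead of `θs` in the exploration statistics `n` rounds after round `k`, then either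
the statistic of `θ` was already large at round `k`, or one of `n + 1` sums of centred increments
deviates from zero by a multiple of `n`. The threshold separating the two drifts is
midway between `ε D̄(θs‖θ₀)` and the positive part of the drift of `θ`. -/
theorem overtake_cases (ω : ℕ → Round A X) (θs θ : M.Θ₁) (k : ℕ) {n : ℕ} (hn : 1 ≤ n)
    (hgap : 0 < G.ε * G.gap θs θ)
    (hle : M.exploreAfter ω (k + n) θs ≤ M.exploreAfter ω (k + n) θ) :
    (n : ℝ) ≤ 2 / (G.ε * G.gap θs θ) * M.exploreAfter ω k θ ∨
    G.ε * G.gap θs θ * n / 2 ≤ -1 * ∑ s ∈ Finset.Ico k (k + n),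
      (exploreIncr θs (ω s) - G.exploreMean θs θs) ∨
    ∃ j < n, G.ε * G.gap θs θ * n / 2 ≤ 1 * ∑ s ∈ Finset.Ico (k + j) (k + n),
      (exploreIncr θ (ω s) - G.exploreMean θs θ) := by
  set g := G.ε * G.gap θs θ with hg
  have hε := G.ε.2.1
  have hn0 : (0 : ℝ) < n := by exact_mod_cast hn
  by_contra! hcon
  obtain ⟨h1, h2, h3⟩ := hcon
  have hself : G.avgKL θs θs = 0 := by
    simp [avgKL, kl, InformationTheory.klDiv_self]
  have hm1 : G.exploreMean θs θs = G.ε * G.avgKL θs M.θ₀ := by rw [exploreMean, hself, sub_zero]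
  obtain ⟨j, hj, hup⟩ := exploreAfter_le_add_sum ω θ k n
  have hlow := sum_exploreIncr_le_exploreAfter ω θs k n
  have hq : M.exploreAfter ω k θ < g * n / 2 := by
    rw [div_mul_eq_mul_div, div_lt_iff₀ hgap] at h1
    linarith
  rw [Finset.sum_sub_distrib, Finset.sum_const, Nat.card_Ico, nsmul_eq_mul, hm1,
    show k + n - k = n by omega] at h2
  have hga : 2 * g = G.ε * min (G.avgKL θs M.θ₀) (G.avgKL θs θ) := by
    rw [hg, gap_eq]; ring
  have hmin1 : 2 * g ≤ G.ε * G.avgKL θs M.θ₀ := by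
    rw [hga]; exact mul_le_mul_of_nonneg_left (min_le_left _ _) hε
  have hmin2 : 2 * g ≤ G.ε * G.avgKL θs θ := by
    rw [hga]; exact mul_le_mul_of_nonneg_left (min_le_right _ _) hε
  have hgn : 0 < g * n := mul_pos hgap hn0
  rcases hj.lt_or_eq with hj | rfl
  · have h4 := h3 j hj
    rw [Finset.sum_sub_distrib, Finset.sum_const, Nat.card_Ico, nsmul_eq_mul, exploreMean,
      show k + n - (k + j) = n - j by omega] at h4
    have hnj : ((n - j : ℕ) : ℝ) ≤ n := by exact_mod_cast Nat.sub_le _ _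
    have hnj0 : (0 : ℝ) ≤ ((n - j : ℕ) : ℝ) := Nat.cast_nonneg _
    -- the drift of `θ` over at most `n` rounds stays `2 g n` below that of `θs` over `n` rounds
    have hd : ((n - j : ℕ) : ℝ) * (G.ε * (G.avgKL θs M.θ₀ - G.avgKL θs θ))
        ≤ n * (G.ε * G.avgKL θs M.θ₀ - 2 * g) := by
      calc _ ≤ ((n - j : ℕ) : ℝ) * (G.ε * G.avgKL θs M.θ₀ - 2 * g) := by
            gcongr; linarith
        _ ≤ _ := by gcongr
    nlinarith
  · simp only [Finset.Ico_self, Finset.sum_empty, add_zero] at hup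
    nlinarith

variable (M) in
/-- The event that `θ` is not behind `θs` in the exploration statistics after `n` rounds. -/
def overtake (θs θ : M.Θ₁) (n : ℕ) : Set (ℕ → Round A X) :=
  {ω | M.exploreAfter ω n θs ≤ M.exploreAfter ω n θ}

theorem measurableSet_overtake (θs θ : M.Θ₁) (n : ℕ) : MeasurableSet (overtake M θs θ n) :=
  measurableSet_le ((measurable_pi_apply θs).comp (M.measurable_exploreAfter n))
    ((measurable_pi_apply θ).comp (M.measurable_exploreAfter n))

/-- For `n = 0` the second term on the right is one, and the first is switched off. -/
theorem measure_overtake_le {r : ℝ≥0} (hsub : M.SubgaussianLLR r) {sched : ℕ → Par}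
    (θs θ : M.Θ₁) {k : ℕ} (hs : ∀ s, k ≤ s → sched (s + 1) = θs)
    {γ : ℝ} (hγ : (r + (r / 2) ^ 2 : ℝ) ≤ γ) (hγ0 : 0 < γ) (hgap : 0 < G.ε * G.gap θs θ) (n : ℕ) :
    G.law sched (overtake M θs θ (k + n))
      ≤ G.law sched {ω | 1 ≤ n ∧ (n : ℝ) ≤ 2 / (G.ε * G.gap θs θ) * M.exploreAfter ω k θ}
        + ENNReal.ofReal ((n + 1) * Real.exp (-(n * ((G.ε * G.gap θs θ) ^ 2 / (8 * γ))))) := by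
  rcases Nat.eq_zero_or_pos n with rfl | hn
  · simpa using prob_le_one
  set g := G.ε * G.gap θs θ with hg
  set e := ENNReal.ofReal (Real.exp (-(n * (g ^ 2 / (8 * γ))))) with he
  have hn0 : (0 : ℝ) < n := by exact_mod_cast hn
  have hexp : ENNReal.ofReal (Real.exp (-((g * n / 2) ^ 2 / (2 * γ * n)))) = e := by
    rw [he]; congr 3; field_simp; ring
  set B₁ : Set (ℕ → Round A X) := {ω | g * n / 2 ≤ -1 * ∑ s ∈ Finset.Ico k (k + n),
      (exploreIncr θs (ω s) - G.exploreMean θs θs)}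
  set B₂ : ℕ → Set (ℕ → Round A X) := fun j =>
    {ω | g * n / 2 ≤ 1 * ∑ s ∈ Finset.Ico (k + j) (k + n),
      (exploreIncr θ (ω s) - G.exploreMean θs θ)}
  have h1 : G.law sched B₁ ≤ e := by
    rw [← hexp]
    exact G.measure_sum_exploreIncr_ge_le hsub θs θs (fun s h _ => hs s h) (by norm_num) hγ hγ0
      hn0 (by positivity) (by simp)
  have h2 : ∀ j, G.law sched (B₂ j) ≤ e := by
    intro j
    rw [← hexp]
    refine G.measure_sum_exploreIncr_ge_le hsub θs θ (fun s h _ => hs s (by omega)) (by norm_num)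
      hγ hγ0 hn0 (by positivity) ?_
    exact_mod_cast (by omega : k + n - (k + j) ≤ n)
  calc G.law sched (overtake M θs θ (k + n))
      ≤ G.law sched ({ω | 1 ≤ n ∧ (n : ℝ) ≤ 2 / g * M.exploreAfter ω k θ} ∪
          (B₁ ∪ ⋃ j ∈ Finset.range n, B₂ j)) := by
        refine measure_mono fun ω hω => ?_
        rcases G.overtake_cases ω θs θ k hn hgap hω with h | h | ⟨j, hj, h⟩
        · exact Or.inl ⟨hn, h⟩
        · exact Or.inr (Or.inl h)
        · exact Or.inr (Or.inr (Set.mem_biUnion (Finset.mem_coe.2 (Finset.mem_range.2 hj)) h))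
    _ ≤ G.law sched {ω | 1 ≤ n ∧ (n : ℝ) ≤ 2 / g * M.exploreAfter ω k θ}
          + (e + ∑ j ∈ Finset.range n, e) := by
        refine (measure_union_le _ _).trans (add_le_add le_rfl ((measure_union_le _ _).trans
          (add_le_add h1 ((measure_biUnion_finset_le _ _).trans
            (Finset.sum_le_sum fun j _ => h2 j)))))
    _ = _ := by
        rw [Finset.sum_const, Finset.card_range, nsmul_eq_mul,
          ENNReal.ofReal_mul (by positivity), ← he, ENNReal.ofReal_add hn0.le zero_le_one,
          ENNReal.ofReal_natCast, ENNReal.ofReal_one]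
        ring

/-- The expected number of rounds after the change at which `θ` is not behind the true
parameter. -/
theorem tsum_measure_overtake_le {r : ℝ≥0} (hsub : M.SubgaussianLLR r) (θs θ : M.Θ₁) {ν : ℕ}
    (hν : 1 ≤ ν) {γ : ℝ} (hγ : (r + (r / 2) ^ 2 : ℝ) ≤ γ) (hγ0 : 0 < γ)
    (hgap : 0 < G.ε * G.gap θs θ) :
    ∑' n, G.law (M.changeAt ν θs) (overtake M θs θ (ν - 1 + n))
      ≤ ENNReal.ofReal (2 / (G.ε * G.gap θs θ) * ∫ ω, M.Q1 ω ν θ ∂(G.law M.noChange)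
        + (1 + 8 * γ / (G.ε * G.gap θs θ) ^ 2) ^ 2) := by
  set g := G.ε * G.gap θs θ with hg
  have hQ : Measurable fun ω : ℕ → Round A X => 2 / g * M.exploreAfter ω (ν - 1) θ :=
    ((measurable_pi_apply θ).comp (M.measurable_exploreAfter (ν - 1))).const_mul _
  have hQ0 : ∀ ω : ℕ → Round A X, 0 ≤ 2 / g * M.exploreAfter ω (ν - 1) θ := fun ω =>
    mul_nonneg (by positivity) (exploreAfter_nonneg ω _ θ)
  have hsets : ∀ n : ℕ, MeasurableSet
      {ω : ℕ → Round A X | 1 ≤ n ∧ (n : ℝ) ≤ 2 / g * M.exploreAfter ω (ν - 1) θ} := fun n =>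
    (MeasurableSet.const _).inter (measurableSet_le measurable_const hQ)
  have h1 : ∑' n : ℕ, G.law (M.changeAt ν θs)
      {ω | 1 ≤ n ∧ (n : ℝ) ≤ 2 / g * M.exploreAfter ω (ν - 1) θ}
      ≤ ENNReal.ofReal (2 / g * ∫ ω, M.Q1 ω ν θ ∂(G.law M.noChange)) := by
    calc _ = ∑' n : ℕ, ∫⁻ ω, (if 1 ≤ n ∧ (n : ℝ) ≤ 2 / g * M.exploreAfter ω (ν - 1) θ
            then 1 else 0) ∂(G.law (M.changeAt ν θs)) := by
          refine tsum_congr fun n => ?_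
          rw [← lintegral_indicator_one (hsets n)]
          exact lintegral_congr fun ω => by simp [Set.indicator_apply]
      _ = ∫⁻ ω, ∑' n : ℕ, (if 1 ≤ n ∧ (n : ℝ) ≤ 2 / g * M.exploreAfter ω (ν - 1) θ
            then 1 else 0) ∂(G.law (M.changeAt ν θs)) := by
          refine (lintegral_tsum fun n => ?_).symm
          exact (Measurable.ite (hsets n) measurable_const measurable_const).aemeasurable
      _ ≤ ∫⁻ ω, ENNReal.ofReal (2 / g * M.exploreAfter ω (ν - 1) θ)
            ∂(G.law (M.changeAt ν θs)) :=
          lintegral_mono fun ω => tsum_indicator_le_ofReal (hQ0 ω)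
      _ = ∫⁻ ω, ENNReal.ofReal (2 / g * M.exploreAfter ω (ν - 1) θ) ∂(G.law M.noChange) := by
          refine G.lintegral_law_congr (ν - 1) (fun t h1 h2 => ?_) hQ.ennreal_ofReal
            fun ω ω' h => by rw [exploreAfter_congr h]
          exact if_pos (by omega)
      _ = _ := by
          rw [← integral_const_mul]
          exact (ofReal_integral_eq_lintegral_ofReal
            ((G.integrable_Q1 hsub ν θ).const_mul (2 / g)) (ae_of_all _ hQ0)).symm
  have hy : 0 < g ^ 2 / (8 * γ) := by positivity
  calc _ ≤ ∑' n : ℕ, (G.law (M.changeAt ν θs)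
          {ω | 1 ≤ n ∧ (n : ℝ) ≤ 2 / g * M.exploreAfter ω (ν - 1) θ}
          + ENNReal.ofReal ((n + 1) * Real.exp (-(n * (g ^ 2 / (8 * γ)))))) :=
        ENNReal.tsum_le_tsum fun n => G.measure_overtake_le hsub θs θ
          (fun s h => if_neg (by omega)) hγ hγ0 hgap n
    _ ≤ _ := by
        rw [ENNReal.tsum_add, ENNReal.ofReal_add (mul_nonneg (by positivity)
          (integral_nonneg fun ω => show 0 ≤ M.Q1 ω ν θ from exploreAfter_nonneg ω _ θ)) (by positivity)]
        refine add_le_add h1 ((tsum_succ_mul_exp_neg_le hy).trans (le_of_eq ?_))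
        rw [one_div_div]

/-! ### Growth of the exploitation statistic of the true parameter -/

/-- The increment of the exploitation statistic of `θ` in a round, before truncation. -/
noncomputable def exploitIncr (θ : M.Θ₁) (x : Round A X) : ℝ :=
  if x.1 = true then 0 else M.logLR θ M.θ₀ x.2.1 x.2.2

theorem measurable_exploitIncr (θ : M.Θ₁) : Measurable (exploitIncr (M := M) θ) :=
  Measurable.ite (measurable_fst (measurableSet_singleton true)) measurable_const
    ((M.measurable_logLR θ M.θ₀).comp measurable_snd)

theorem sum_exploitIncr_le_exploitAfter (ω : ℕ → Round A X) (θ : M.Θ₁) (k n : ℕ) :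
    ∑ s ∈ Finset.Ico k (k + n), exploitIncr θ (ω s) ≤ M.exploitAfter ω (k + n) θ := by
  induction n with
  | zero =>
    simp only [add_zero, Finset.Ico_self, Finset.sum_empty]
    cases k with
    | zero => exact le_rfl
    | succ k => exact le_max_right _ _
  | succ n ih =>
    rw [← add_assoc, Finset.sum_Ico_succ_top (by omega)]
    refine le_trans ?_ (le_max_left _ _)
    simpa [exploitIncr] using ih

theorem maxKL_eq (θ : M.Θ₁) : M.maxKL θ = (M.kl θ M.θ₀ (G.best θ)).toReal := by
  rw [maxKL]
  congr 1
  exact le_antisymm (iSup_le (G.best_max θ)) (le_iSup (M.kl θ M.θ₀) _)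

theorem maxKL_pos (G : EpsGCD M) {r : ℝ≥0} (hsub : M.SubgaussianLLR r) (hident : M.Identifiable) (θ : M.Θ₁) :
    0 < M.maxKL θ := by
  obtain ⟨a, ha⟩ := hident.1 θ θ.2
  rw [G.maxKL_eq]
  exact ENNReal.toReal_pos (ha.trans_le (G.best_max θ a)).ne'
    (hsub.kl_ne_top (isParam_post θ) isParam_pre _)

/-- The greedy action for the exploration statistics `q` is the most informative one for `θs`. -/
def Greedy (θs : M.Θ₁) (q : M.Θ₁ → ℝ) : Prop := G.best (G.select q) = G.best θs

theorem measurableSet_greedy (θs : M.Θ₁) : MeasurableSet {q | G.Greedy θs q} := by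
  have : {q | G.Greedy θs q} = ⋃ θ ∈ {θ : M.Θ₁ | G.best θ = G.best θs}, G.select ⁻¹' {θ} := by
    ext q; simp [Greedy]
  rw [this]
  exact MeasurableSet.biUnion (Set.to_countable _) fun θ _ => G.measurable_select θ

open scoped Classical in
/-- The factor contributed by a round to the exponential supermartingale of the exploitation
statistic: `e^{-l Z}` in an exploitation round with log-likelihood ratio `Z`, multiplied by `e^y`
if the greedy action is the right one. -/
noncomputable def exploitFactor (l y : ℝ) (θs : M.Θ₁) (q : M.Θ₁ → ℝ) (x : Round A X) : ℝ≥0∞ :=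
  ENNReal.ofReal (Real.exp (-l * exploitIncr θs x + if G.Greedy θs q then y else 0))

theorem measurable_exploitFactor (l y : ℝ) (θs : M.Θ₁) :
    Measurable (Function.uncurry (G.exploitFactor l y θs)) := by
  classical
  have h : Measurable fun q : M.Θ₁ → ℝ => if G.Greedy θs q then y else 0 :=
    Measurable.ite (G.measurableSet_greedy θs) measurable_const measurable_const
  have := ((((measurable_exploitIncr θs).const_mul (-l)).comp
    (measurable_snd (α := M.Θ₁ → ℝ))).add (h.comp measurable_fst)).exp.ennreal_ofReal
  convert this using 2
  simp only [Function.uncurry, exploitFactor, Pi.add_apply, Function.comp_apply]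

/-- When the greedy action is the right one, the log-likelihood ratio has drift `maxKL θs` and the
`-l`-th exponential moment of the increment decreases by a constant factor; when it is not, this
moment is still at most one. -/
theorem lintegral_exploitFactor_le_one {r : ℝ≥0} (hsub : M.SubgaussianLLR r) (θs : M.Θ₁)
    {l : ℝ} (hl : 0 ≤ l) (hl1 : l ≤ 1) (hlr : r * l ≤ M.maxKL θs) (hlμ : l * M.maxKL θs ≤ 2)
    (q : M.Θ₁ → ℝ) :
    ∫⁻ x, G.exploitFactor l ((1 - G.ε) * (l * M.maxKL θs) / 4) θs q x ∂(G.roundKernel θs q)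
      ≤ 1 := by
  set μ := M.maxKL θs with hμ
  set y := (1 - G.ε) * (l * μ) / 4 with hy
  have hs := isParam_post θs
  have h0 : M.IsParam M.θ₀ := isParam_pre
  have hε := G.ε.2.1
  have hε1 : 0 ≤ 1 - (G.ε : ℝ) := by linarith [G.ε.2.2]
  have hμ0 : 0 ≤ μ := ENNReal.toReal_nonneg
  have hlμ0 : 0 ≤ l * μ := mul_nonneg hl hμ0
  rw [G.lintegral_roundKernel _ _ (G.measurable_exploitFactor l y θs).of_uncurry_left]
  simp only [exploitFactor, exploitIncr, if_true, Bool.false_eq_true, if_false, lintegral_const,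
    measure_univ, mul_one, mul_zero, zero_add]
  by_cases hq : G.Greedy θs q
  · have hq' : G.best (G.select q) = G.best θs := hq
    simp only [hq, if_true, hq']
    have hint : ∫⁻ x, ENNReal.ofReal (Real.exp (-l * M.logLR θs M.θ₀ (G.best θs) x + y))
        ∂(M.obs θs (G.best θs)) ≤ ENNReal.ofReal (Real.exp y * Real.exp (-(l * μ / 2))) := by
      calc _ = ∫⁻ x, ENNReal.ofReal (Real.exp y) *
              ENNReal.ofReal (Real.exp (-l * M.logLR θs M.θ₀ (G.best θs) x))
              ∂(M.obs θs (G.best θs)) := by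
            refine lintegral_congr fun x => ?_
            rw [← ENNReal.ofReal_mul (Real.exp_pos _).le, ← Real.exp_add, add_comm]
        _ ≤ _ := by
            rw [lintegral_const_mul' _ _ ENNReal.ofReal_ne_top,
              ENNReal.ofReal_mul (Real.exp_pos _).le]
            gcongr
            refine (hsub.lintegral_exp_le hs hs h0 _ (-l)).trans (ENNReal.ofReal_le_ofReal ?_)
            rw [← hsub.toReal_kl hs h0, ← G.maxKL_eq, ← hμ]
            refine Real.exp_le_exp.2 ?_
            nlinarith [mul_le_mul_of_nonneg_left hlr hl]
    calc _ ≤ ENNReal.ofReal G.ε * ENNReal.ofReal (Real.exp y) + ENNReal.ofReal (1 - G.ε) *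
            ENNReal.ofReal (Real.exp y * Real.exp (-(l * μ / 2))) := by gcongr
      _ = ENNReal.ofReal (Real.exp y * (G.ε + (1 - G.ε) * Real.exp (-(l * μ / 2)))) := by
          rw [← ENNReal.ofReal_mul hε, ← ENNReal.ofReal_mul hε1,
            ← ENNReal.ofReal_add (by positivity) (by positivity)]
          congr 1; ring
      _ ≤ 1 := by
          rw [ENNReal.ofReal_le_one]
          have h1 := exp_neg_le_one_sub_half (x := l * μ / 2) (by linarith) (by linarith)
          have h2 : G.ε + (1 - G.ε) * Real.exp (-(l * μ / 2)) ≤ Real.exp (-y) := by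
            have h3 := Real.add_one_le_exp (-y)
            have h4 := mul_le_mul_of_nonneg_left h1 hε1
            rw [hy] at h3 ⊢
            nlinarith
          calc _ ≤ Real.exp y * Real.exp (-y) := by gcongr
            _ = 1 := by rw [← Real.exp_add]; simp
  · simp only [hq, if_false, add_zero, Real.exp_zero, ENNReal.ofReal_one, mul_one]
    calc _ ≤ ENNReal.ofReal G.ε + ENNReal.ofReal (1 - G.ε) * 1 := by
          gcongr
          exact hsub.lintegral_exp_neg_le_one hs h0 _ hl hl1
      _ = 1 := by
          rw [mul_one, ← ENNReal.ofReal_add hε hε1]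
          simp

open scoped Classical in
theorem prod_exploitFactor (l y : ℝ) (θs : M.Θ₁) (ω : ℕ → Round A X) (k n : ℕ) :
    ∏ s ∈ Finset.Ico k (k + n), G.exploitFactor l y θs (M.exploreAfter ω s) (ω s)
      = ENNReal.ofReal (Real.exp (-l * ∑ s ∈ Finset.Ico k (k + n), exploitIncr θs (ω s)
        + (n - ((Finset.range n).filter
            fun s => ¬ G.Greedy θs (M.exploreAfter ω (k + s))).card) * y)) := by
  simp only [exploitFactor]
  rw [← ENNReal.ofReal_prod_of_nonneg fun _ _ => (Real.exp_pos _).le, ← Real.exp_sum,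
    Finset.sum_add_distrib, ← Finset.mul_sum]
  congr 3
  rw [Finset.sum_Ico_eq_sum_range, Nat.add_sub_cancel_left, ← Finset.sum_filter,
    Finset.sum_const, nsmul_eq_mul]
  congr 1
  have := Finset.card_filter_add_card_filter_not (s := Finset.range n)
    (fun s => G.Greedy θs (M.exploreAfter ω (k + s)))
  rw [Finset.card_range] at this
  have h2 : (n : ℝ) = _ := congrArg (Nat.cast (R := ℝ)) this.symm
  rw [h2]
  push_cast
  ring

end EpsGCD

/-! ### Detection delay -/

theorem ENat.toENNReal_le_tsum (e : ℕ∞) :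
    (e : ℝ≥0∞) ≤ ∑' n : ℕ, (if (n : ℕ∞) < e then 1 else 0 : ℝ≥0∞) := by
  induction e using ENat.recTopCoe with
  | top => simp
  | coe N =>
    refine le_trans (le_of_eq ?_) (ENNReal.sum_le_tsum (Finset.range N))
    rw [Finset.sum_congr rfl fun n hn => if_pos (Nat.cast_lt.2 (Finset.mem_range.1 hn))]
    simp

/-- At most `2 K` positive integers `n` are such that at least half of the natural numbers
below `n` satisfy `p`, where `K` is the number of all natural numbers with `p`. -/
theorem tsum_card_filter_le (p : ℕ → Prop) [DecidablePred p] :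
    ∑' n : ℕ, (if 1 ≤ n ∧ n ≤ 2 * ((Finset.range n).filter p).card then 1 else 0 : ℝ≥0∞)
      ≤ 2 * ∑' s : ℕ, (if p s then 1 else 0 : ℝ≥0∞) := by
  set T : ℝ≥0∞ := ∑' s : ℕ, (if p s then 1 else 0 : ℝ≥0∞) with hT
  by_cases htop : T = ∞
  · simp [htop]
  have h2T : 2 * T ≠ ∞ := ENNReal.mul_ne_top (by simp) htop
  have hcard : ∀ n, (((Finset.range n).filter p).card : ℝ≥0∞) ≤ T := by
    intro n
    refine le_trans (le_of_eq ?_) (ENNReal.sum_le_tsum (Finset.range n))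
    rw [← Finset.sum_filter]
    simp
  rw [← ENNReal.ofReal_toReal h2T]
  refine le_trans (ENNReal.tsum_le_tsum fun n => ?_)
    (tsum_indicator_le_ofReal (ENNReal.toReal_nonneg (a := 2 * T)))
  split_ifs with h1 h2
  · exact le_rfl
  · refine absurd ⟨h1.1, ?_⟩ h2
    rw [← ENNReal.ofReal_le_iff_le_toReal h2T, ENNReal.ofReal_natCast]
    calc (n : ℝ≥0∞) ≤ ((2 * ((Finset.range n).filter p).card : ℕ) : ℝ≥0∞) := by
          exact_mod_cast h1.2
      _ ≤ 2 * T := by push_cast; gcongr; exact hcard n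
  · exact zero_le
  · exact le_rfl

namespace EpsGCD

open BanditModel

variable {Par A X : Type*} [MeasurableSpace A] [MeasurableSpace X] {M : BanditModel Par A X}
  (G : EpsGCD M)

theorem exploitAfter_lt_of_lt_stopTime_sub {β : ℝ} {ω : ℕ → Round A X} {ν n : ℕ} (hν : 1 ≤ ν)
    (h : (n : ℕ∞) < M.stopTime β ω - ν) (θ : M.Θ₁) :
    M.exploitAfter ω (ν - 1 + n) θ < Real.log β := by
  by_contra! hcon
  have h1 : ((n + ν : ℕ) : ℕ∞) < M.stopTime β ω := by
    push_cast
    exact lt_tsub_iff_right.1 h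
  refine absurd h1 (not_lt.2 (iInf₂_le (n + ν) ⟨by omega, θ, ?_⟩))
  rw [Q2, show n + ν - 1 = ν - 1 + n by omega]
  exact hcon

/-- If the greedy action is not the most informative one for `θs`, a rival of `θs` is not behind
`θs` in the exploration statistics. -/
theorem exists_rival_of_not_greedy {θs : M.Θ₁} {ω : ℕ → Round A X} {n : ℕ}
    (h : ¬ G.Greedy θs (M.exploreAfter ω n)) : ∃ θ ∈ G.rivals θs, ω ∈ overtake M θs θ n := by
  classical
  refine ⟨G.select (M.exploreAfter ω n), ?_, G.select_max _ _⟩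
  rw [rivals, Finset.mem_filter]
  exact ⟨Finset.mem_univ _, h⟩

/-- The delay is at most a deterministic number `n₀` of rounds, plus a geometrically discounted
sum of values of the exponential supermartingale of the exploitation statistic, plus twice the
number of pairs of a rival and a round from the change on at whose beginning it is not behind the
true parameter. -/
theorem delay_le {β l y : ℝ} {ν n₀ : ℕ} (hν : 1 ≤ ν) (hl : 0 ≤ l) (hy : 0 ≤ y) (hn₀ : 1 ≤ n₀)
    (hL : l * Real.log β ≤ n₀ * (y / 2)) (θs : M.Θ₁) (ω : ℕ → Round A X) :
    ((M.stopTime β ω - ν : ℕ∞) : ℝ≥0∞) ≤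
      ∑' n : ℕ, ((if n < n₀ then 1 else
        ENNReal.ofReal (Real.exp (-(((n - n₀ : ℕ) : ℝ) * (y / 2)))) *
        ∏ s ∈ Finset.Ico (ν - 1) (ν - 1 + n), G.exploitFactor l y θs (M.exploreAfter ω s) (ω s)))
      + 2 * ∑' n : ℕ, ∑ θ ∈ G.rivals θs, (overtake M θs θ (ν - 1 + n)).indicator 1 ω := by
  classical
  set p : ℕ → Prop := fun s => ¬ G.Greedy θs (M.exploreAfter ω (ν - 1 + s)) with hp
  have hcount : ∑' n : ℕ, (if 1 ≤ n ∧ n ≤ 2 * ((Finset.range n).filter p).card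
        then 1 else 0 : ℝ≥0∞)
      ≤ 2 * ∑' n : ℕ, ∑ θ ∈ G.rivals θs, (overtake M θs θ (ν - 1 + n)).indicator 1 ω := by
    refine (tsum_card_filter_le p).trans ?_
    gcongr with n
    split_ifs with hpn
    · obtain ⟨θ, hθ, h⟩ := G.exists_rival_of_not_greedy hpn
      refine le_trans ?_ (Finset.single_le_sum (fun _ _ => zero_le) hθ)
      simp [h]
    · exact zero_le
  refine le_trans ?_ (add_le_add le_rfl hcount)
  rw [← ENNReal.tsum_add]
  refine (ENat.toENNReal_le_tsum _).trans (ENNReal.tsum_le_tsum fun n => ?_)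
  split_ifs with h1 h2 h3 h3
  · exact le_self_add
  · exact le_self_add
  · exact le_add_self
  · rw [add_zero, G.prod_exploitFactor, ← ENNReal.ofReal_mul (Real.exp_pos _).le, ← Real.exp_add,
      ENNReal.one_le_ofReal]
    refine Real.one_le_exp ?_
    have hS := (sum_exploitIncr_le_exploitAfter ω θs (ν - 1) n).trans_lt
      (exploitAfter_lt_of_lt_stopTime_sub hν h1 θs)
    have hJ : 2 * (((Finset.range n).filter p).card : ℝ) ≤ n := by
      have : 2 * ((Finset.range n).filter p).card ≤ n := by
        by_contra! hcon
        exact h3 ⟨by omega, hcon.le⟩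
      exact_mod_cast this
    have hlS := mul_le_mul_of_nonneg_left hS.le hl
    have hJy := mul_le_mul_of_nonneg_right hJ hy
    rw [Nat.cast_sub (not_lt.1 h2)]
    nlinarith
  all_goals exact zero_le

/-- The mean delay in terms of an exponent `l` small enough for the exponential supermartingale and
of a number `n₀` of rounds after which its bound on the probability of not having stopped decays
geometrically. -/
theorem lintegral_delay_le {r : ℝ≥0} (hsub : M.SubgaussianLLR r) {β l : ℝ} {ν n₀ : ℕ}
    (hν : 1 ≤ ν) (θs : M.Θ₁) (hl : 0 < l) (hl1 : l ≤ 1) (hlr : r * l ≤ M.maxKL θs)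
    (hlμ : l * M.maxKL θs ≤ 2) (hμ : 0 < M.maxKL θs) (hε1 : (G.ε : ℝ) < 1) (hn₀ : 1 ≤ n₀)
    (hL : 8 * Real.log β / ((1 - G.ε) * M.maxKL θs) ≤ n₀) :
    ∫⁻ ω, ((M.stopTime β ω - ν : ℕ∞) : ℝ≥0∞) ∂(G.law (M.changeAt ν θs)) ≤
      ENNReal.ofReal (n₀ + (1 + 8 / ((1 - G.ε) * (l * M.maxKL θs))))
      + 2 * ∑ θ ∈ G.rivals θs,
          ∑' n : ℕ, G.law (M.changeAt ν θs) (overtake M θs θ (ν - 1 + n)) := by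
  set μ := M.maxKL θs
  set c : ℝ := 1 - G.ε with hc
  have hc0 : 0 < c := by linarith
  set y := c * (l * μ) / 4 with hy
  have hy0 : 0 < y := by positivity
  have hL' : l * Real.log β ≤ n₀ * (y / 2) := by
    rw [div_le_iff₀ (by positivity)] at hL
    rw [hy]
    nlinarith
  let U : ℕ → (ℕ → Round A X) → ℝ≥0∞ := fun n ω =>
    ∏ s ∈ Finset.Ico (ν - 1) (ν - 1 + n), G.exploitFactor l y θs (M.exploreAfter ω s) (ω s)
  have hUm : ∀ n, Measurable (U n) := fun n => Finset.measurable_fun_prod _ fun s _ =>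
    (G.measurable_exploitFactor l y θs).comp
      ((M.measurable_exploreAfter s).prodMk (measurable_pi_apply s))
  have hU : ∀ n, ∫⁻ ω, U n ω ∂(G.law (M.changeAt ν θs)) ≤ 1 := fun n =>
    G.lintegral_prod_le_one (θ := θs) _ (fun s h _ => if_neg (by omega))
      (G.measurable_exploitFactor l y θs)
      (G.lintegral_exploitFactor_le_one hsub θs hl.le hl1 hlr hlμ)
  let a : ℕ → (ℕ → Round A X) → ℝ≥0∞ := fun n ω => if n < n₀ then 1 else
    ENNReal.ofReal (Real.exp (-(((n - n₀ : ℕ) : ℝ) * (y / 2)))) * U n ω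
  have ham : ∀ n, Measurable (a n) := fun n => by
    by_cases h : n < n₀
    · simp only [a, h, if_true]; exact measurable_const
    · simp only [a, h, if_false]; exact (hUm n).const_mul _
  have hind : ∀ n θ, Measurable ((overtake M θs θ (ν - 1 + n)).indicator
      (1 : (ℕ → Round A X) → ℝ≥0∞)) := fun n θ =>
    measurable_one.indicator (measurableSet_overtake θs θ _)
  have hsum : ∀ n, Measurable fun ω => ∑ θ ∈ G.rivals θs,
      (overtake M θs θ (ν - 1 + n)).indicator (1 : (ℕ → Round A X) → ℝ≥0∞) ω := fun n =>
    Finset.measurable_fun_sum _ fun θ _ => hind n θ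
  calc _ ≤ ∫⁻ ω, ∑' n, a n ω + 2 * ∑' n, ∑ θ ∈ G.rivals θs,
          (overtake M θs θ (ν - 1 + n)).indicator 1 ω ∂(G.law (M.changeAt ν θs)) :=
        lintegral_mono fun ω => G.delay_le hν hl.le hy0.le hn₀ hL' θs ω
    _ = ∑' n, ∫⁻ ω, a n ω ∂(G.law (M.changeAt ν θs))
        + 2 * ∑ θ ∈ G.rivals θs,
          ∑' n : ℕ, G.law (M.changeAt ν θs) (overtake M θs θ (ν - 1 + n)) := by
        rw [lintegral_add_left (Measurable.tsum ham),
          lintegral_tsum fun n => (ham n).aemeasurable,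
          lintegral_const_mul _ (Measurable.tsum hsum),
          lintegral_tsum fun n => (hsum n).aemeasurable]
        congr 2
        rw [← Summable.tsum_finsetSum fun _ _ => ENNReal.summable]
        refine tsum_congr fun n => ?_
        rw [lintegral_finsetSum _ fun θ _ => hind n θ]
        exact Finset.sum_congr rfl fun θ _ =>
          lintegral_indicator_one (measurableSet_overtake θs θ _)
    _ ≤ _ := by
        gcongr
        have h1 : ∀ n, ∫⁻ ω, a n ω ∂(G.law (M.changeAt ν θs)) ≤ if n < n₀ then 1 else
            ENNReal.ofReal (Real.exp (-(((n - n₀ : ℕ) : ℝ) * (y / 2)))) := by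
          intro n
          by_cases h : n < n₀
          · simp [a, h]
          · simp only [a, h, if_false]
            rw [lintegral_const_mul _ (hUm n)]
            exact mul_le_of_le_one_right' (hU n)
        refine (ENNReal.tsum_le_tsum h1).trans ?_
        rw [← ENNReal.summable.sum_add_tsum_nat_add' (k := n₀),
          ENNReal.ofReal_add (by positivity) (by positivity)]
        refine add_le_add (le_of_eq ?_) ?_
        · rw [Finset.sum_congr rfl fun n hn => if_pos (Finset.mem_range.1 hn)]
          simp
        · simp only [Nat.not_lt.2 (Nat.le_add_left n₀ _), if_false, Nat.add_sub_cancel]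
          refine (tsum_exp_neg_le (half_pos hy0)).trans (le_of_eq ?_)
          congr 2
          rw [hy]
          field_simp
          norm_num

/-- Exploration plays the most informative action of `θs` with positive probability, so it detects
the change on average; hence the gap of `θ` is positive if exploration separates `θ` from `θs`. -/
theorem gap_pos {r : ℝ≥0} [MeasurableSingletonClass A] (hsub : M.SubgaussianLLR r)
    (hident : M.Identifiable) {θs θ : M.Θ₁} (hπ : 0 < G.π {G.best θs})
    (h : 0 < G.avgKL θs θ) : 0 < G.gap θs θ := by
  have hs := isParam_post θs
  have h0 : 0 < G.avgKL θs M.θ₀ := by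
    rw [G.avgKL_eq_integral hsub hs isParam_pre]
    have h1 : (G.π.real {G.best θs}) * M.maxKL θs ≤ ∫ a, (M.kl θs M.θ₀ a).toReal ∂G.π := by
      rw [G.maxKL_eq, ← smul_eq_mul, 
        ← integral_singleton (fun a => (M.kl θs M.θ₀ a).toReal) (G.best θs)]
      exact setIntegral_le_integral (G.integrable_toReal_kl hsub hs isParam_pre)
        (ae_of_all _ fun a => ENNReal.toReal_nonneg)
    refine lt_of_lt_of_le (mul_pos ?_ (G.maxKL_pos hsub hident θs)) h1
    exact ENNReal.toReal_pos hπ.ne' (measure_ne_top _ _)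
  rw [gap_eq]
  exact half_pos (lt_min h0 h)

/-- The bound on the mean delay for the exponent `min (μ / r) (2 / μ)`, where `μ` is the largest
divergence of `θs` from the pre-change parameter. -/
theorem lintegral_delay_le_ofReal {r D : ℝ≥0} [MeasurableSingletonClass A] (hr : 0 < r)
    (hsub : M.SubgaussianLLR r) (hident : M.Identifiable) {β : ℝ} {ν : ℕ} {θs : M.Θ₁}
    (hβ : 1 ≤ β) (hν : 1 ≤ ν) (hε0 : 0 < (G.ε : ℝ)) (hε1 : (G.ε : ℝ) < 1)
    (hπ : 0 < G.π {G.best θs}) (hriv : ∀ θ ∈ G.rivals θs, 0 < G.avgKL θs θ) :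
    ∫⁻ ω, ((M.stopTime β ω - ν : ℕ∞) : ℝ≥0∞) ∂(G.law (M.changeAt ν θs)) ≤
      ENNReal.ofReal (
        8 * Real.log β / ((1 - G.ε) * M.maxKL θs)
        + 100 / (1 - G.ε) * (1 + r / M.maxKL θs ^ 2)
        + ∑ θ ∈ G.rivals θs,
            (4 / (G.ε * G.gap θs θ) * ∫ ω, M.Q1 ω ν θ ∂(G.law M.noChange)
              + 8 * (1 + 8 * (r + r ^ 2 + 2 * D ^ 2) / (G.ε ^ 2 * G.gap θs θ ^ 2)) ^ 2)) := by
  have hμ := G.maxKL_pos hsub hident θs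
  have hμr : M.maxKL θs ≤ r / 2 := by
    rw [G.maxKL_eq]; exact hsub.toReal_kl_le (isParam_post θs) isParam_pre _
  set μ := M.maxKL θs with hμdef
  set c : ℝ := 1 - G.ε with hc
  have hc0 : 0 < c := by linarith
  have hc1 : c ≤ 1 := by linarith
  have hr0 : (0 : ℝ) < r := hr
  set L := 8 * Real.log β / (c * μ) with hLdef
  have hL0 : 0 ≤ L := div_nonneg (mul_nonneg (by norm_num) (Real.log_nonneg hβ)) (by positivity)
  -- `l ≤ μ / r` keeps the drift dominant over the noise, `l ≤ 2 / μ` keeps `1 - e^{-l μ / 2}`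
  -- comparable with `l μ`
  set l := min (μ / r) (2 / μ) with hl
  have hl0 : 0 < l := lt_min (by positivity) (by positivity)
  have hlr : r * l ≤ μ := by
    have := min_le_left (μ / r) (2 / μ)
    rwa [← hl, le_div_iff₀ hr0, mul_comm] at this
  have hlμ : l * μ ≤ 2 := by
    have := min_le_right (μ / r) (2 / μ)
    rwa [← hl, le_div_iff₀ hμ] at this
  have hl1 : l ≤ 1 := by nlinarith
  have hinv : 8 / (c * (l * μ)) ≤ 8 / c * (1 / 2 + r / μ ^ 2) := by
    rw [div_mul_eq_div_mul_one_div]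
    gcongr
    rcases min_choice (μ / r) (2 / μ) with h | h
    · rw [hl, h, show 1 / (μ / r * μ) = r / μ ^ 2 by field_simp]
      linarith
    · rw [hl, h, show 1 / (2 / μ * μ) = 1 / 2 by field_simp]
      have : 0 ≤ r / μ ^ 2 := by positivity
      linarith
  have hceil := Nat.ceil_lt_add_one hL0
  have hmain := G.lintegral_delay_le hsub (β := β) (n₀ := ⌈L⌉₊ + 1) hν θs hl0 hl1 hlr hlμ hμ hε1
    (by omega) (by push_cast; linarith [Nat.le_ceil L])
  have hone : 1 ≤ 1 / c := by rw [le_div_iff₀ hc0]; linarith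
  have hfirst : ((⌈L⌉₊ + 1 : ℕ) : ℝ) + (1 + 8 / (c * (l * μ)))
      ≤ L + 100 / c * (1 + r / μ ^ 2) := by
    push_cast
    have h1 : 0 ≤ r / μ ^ 2 / c := by positivity
    have h2 : 8 / c * (1 / 2 + r / μ ^ 2) = 4 * (1 / c) + 8 * (r / μ ^ 2 / c) := by ring
    have h3 : 100 / c * (1 + r / μ ^ 2) = 100 * (1 / c) + 100 * (r / μ ^ 2 / c) := by ring
    linarith
  have hterm0 : ∀ θ ∈ G.rivals θs,
      0 ≤ 4 / (G.ε * G.gap θs θ) * ∫ ω, M.Q1 ω ν θ ∂(G.law M.noChange)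
        + 8 * (1 + 8 * (r + r ^ 2 + 2 * D ^ 2) / (G.ε ^ 2 * G.gap θs θ ^ 2)) ^ 2 := by
    intro θ hθ
    have hg := G.gap_pos hsub hident hπ (hriv θ hθ)
    have hI : 0 ≤ ∫ ω, M.Q1 ω ν θ ∂(G.law M.noChange) :=
      integral_nonneg fun ω => show 0 ≤ M.Q1 ω ν θ from exploreAfter_nonneg ω _ θ
    positivity
  rw [ENNReal.ofReal_add (by positivity) (Finset.sum_nonneg hterm0),
    ENNReal.ofReal_sum_of_nonneg hterm0]
  refine hmain.trans (add_le_add (ENNReal.ofReal_le_ofReal hfirst) ?_)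
  rw [Finset.mul_sum]
  refine Finset.sum_le_sum fun θ hθ => ?_
  have hg := G.gap_pos hsub hident hπ (hriv θ hθ)
  have hγ : (r + (r / 2) ^ 2 : ℝ) ≤ r + r ^ 2 + 2 * D ^ 2 := by
    nlinarith [sq_nonneg (r : ℝ), sq_nonneg (D : ℝ)]
  calc _ ≤ 2 * ENNReal.ofReal _ := mul_le_mul_right
        (G.tsum_measure_overtake_le hsub θs θ hν hγ (by positivity) (mul_pos hε0 hg)) 2
    _ ≤ _ := by
        rw [← ENNReal.ofReal_ofNat 2, ← ENNReal.ofReal_mul (by norm_num)]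
        refine ENNReal.ofReal_le_ofReal ?_
        rw [mul_pow, mul_add, ← mul_assoc]
        refine add_le_add (le_of_eq (by ring)) ?_
        gcongr
        norm_num

end EpsGCD

theorem mainTheorem1 {Par A X : Type*} [MeasurableSpace A] [MeasurableSingletonClass A]
    [MeasurableSpace X] (M : BanditModel Par A X) (G : EpsGCD M) (r D : ℝ≥0) (hr : 0 < r)
    (hident : M.Identifiable) (hKL : M.BoundedKL D) (hsub : M.SubgaussianLLR r) :
    (∀ (α β : ℝ) (m : ℕ), 0 < α → α < 1 → (m * M.Θ₁.card : ℝ) / α ≤ β →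
      G.law M.noChange {ω | M.stopTime β ω < m} ≤ ENNReal.ofReal α) ∧
    (∀ (β : ℝ) (ν : ℕ) (θs : M.Θ₁), 1 ≤ β → 1 ≤ ν → 0 < (G.ε : ℝ) → (G.ε : ℝ) < 1 →
      0 < G.π {G.best θs} → (∀ θ ∈ G.rivals θs, 0 < G.avgKL θs θ) →
      (∀ θ, Integrable (fun ω => M.Q1 ω ν θ) (G.law M.noChange)) ∧
      ∫⁻ ω, ((M.stopTime β ω - ν : ℕ∞) : ℝ≥0∞) ∂(G.law (M.changeAt ν θs)) ≤
        ENNReal.ofReal (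
          8 * Real.log β / ((1 - G.ε) * M.maxKL θs)
          + 100 / (1 - G.ε) * (1 + r / M.maxKL θs ^ 2)
          + ∑ θ ∈ G.rivals θs,
              (4 / (G.ε * G.gap θs θ) * ∫ ω, M.Q1 ω ν θ ∂(G.law M.noChange)
                + 8 * (1 + 8 * (r + r ^ 2 + 2 * D ^ 2) / (G.ε ^ 2 * G.gap θs θ ^ 2)) ^ 2))) :=
  ⟨fun _ _ _ hα _ hβ => G.measure_stopTime_lt_le hsub hα hβ,
    fun _ ν _ hβ hν hε0 hε1 hπ hriv => ⟨G.integrable_Q1 hsub ν,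
      G.lintegral_delay_le_ofReal hr hsub hident hβ hν hε0 hε1 hπ hriv⟩⟩
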